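/- Let $q\ge 1$, let $\Omega_q=\{x\in\mathbb{R}^{q+1}:\|x\|=1\}$ and let $\nu_q$ be the uniform distribution on $\Omega_q$. For $x\in[-1,1]$ let $$F_q(x)=\mathrm{B}\left(\tfrac12,\tfrac q2\right)^{-1}\int_{-1}^x(1-t^2)^{q/2-1}\,\mathrm{d}t$$ be the distribution function of the projection of $\nu_q$ onto a fixed direction. For $n\ge1$ and $X_1,\ldots,X_n\in\Omega_q$, let $F_{n,\gamma}(x)=\frac1n\#\{i:\gamma'X_i\le x\}$ be the empirical distribution function of the projections onto $\gamma\in\Omega_q$, let $\theta_{ij}=\cos^{-1}(X_i'X_j)\in[0,\pi]$, and for the weight $w(u)=1/(u(1-u))$ put $$P_{n,q}^{\mathrm{AD}}=n\int_{\Omega_q}\left[\int_{-1}^1\left(F_{n,\gamma}(x)-F_q(x)\right)^2 w(F_q(x))\,\mathrm{d}F_q(x)\right]\nu_q(\mathrm{d}\gamma).$$ Then, for all $q\ge1$, $n\ge1$ and $X_1,\ldots,X_n\in\Omega_q$, the statistic $P_{n,q}^{\mathrm{AD}}$ is finite and $$P_{n,q}^{\mathrm{AD}}=\frac2n\sum_{1\le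 i<j\le n}\psi_q^{\mathrm{AD}}(\theta_{ij})+n,$$ where $\psi_q^{\mathrm{AD}}(0)=0$ and, for $\theta\in(0,\pi]$, the kernel $\psi_q^{\mathrm{AD}}$ is given as follows. For $q=1$, $$\psi_1^{\mathrm{AD}}(\theta)=-2\log(2\pi)+\frac1\pi\left\{\theta\log\theta+(2\pi-\theta)\log(2\pi-\theta)\right\}.$$ For $q=2$, $$\psi_2^{\mathrm{AD}}(\theta)=-\log 4+\frac2\pi\int_0^{\cos(\theta/2)}\log\left(\frac{1+t}{1-t}\right)\cos^{-1}\left(\frac{t\tan(\theta/2)}{(1-t^2)^{1/2}}\right)\mathrm{d}t.$$ For $q=3$, with $s(\theta)=\theta-\sin\theta$, $$\begin{aligned}\psi_3^{\mathrm{AD}}(\theta)=&-2\log(2\pi)+\frac1\pi\left\{s(\theta)\log s(\theta)+(2\pi-s(\theta))\log(2\pi-s(\theta))\right\}\\&-\frac4\pi\tan\left(\tfrac\theta2\right)\int_0^{\cos(\theta/2)}t\log\left(\frac{\pi}{\cos^{-1}(t)-t(1-t^2)^{1/2}}-1\right)\mathrm{d}t.\end{aligned}$$ For every $q\ge2$ (in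 agreement with the previous two expressions when $q=2,3$), $$\psi_q^{\mathrm{AD}}(\theta)=-\log4+4\int_0^{\cos(\theta/2)}\log\left(\frac{F_q(t)}{1-F_q(t)}\right)\left(1-F_{q-1}\left(\frac{t\tan(\theta/2)}{(1-t^2)^{1/2}}\right)\right)\mathrm{d}F_q(t).$$ At $\theta=\pi$ the integrals over $[0,\cos(\theta/2)]=\{0\}$, including the term with the factor $\tan(\theta/2)$, are read as $0$. -/

import Mathlib

open MeasureTheory
open scoped ENNReal

namespace ProjectedECDF

noncomputable section

/-- The unit hypersphere `Ω_q` in `ℝ^(q+1)`. -/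
abbrev Omega (q : ℕ) : Type := Metric.sphere (0 : EuclideanSpace ℝ (Fin (q + 1))) 1

/-- The uniform distribution `ν_q` on `Ω_q`: the surface measure divided by the total surface
area. -/
def uniformSphere (q : ℕ) : Measure (Omega q) :=
  ((volume : Measure (EuclideanSpace ℝ (Fin (q + 1)))).toSphere Set.univ)⁻¹ •
    (volume : Measure (EuclideanSpace ℝ (Fin (q + 1)))).toSphere

/-- The density `B(1/2, q/2)⁻¹ (1 - t²)^(q/2 - 1)`, `t ∈ [-1, 1]`, of the projection of a uniform
point of `Ω_q` onto a fixed direction. -/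
def projDensity (q : ℕ) (t : ℝ) : ℝ :=
  (ProbabilityTheory.beta (1 / 2) ((q : ℝ) / 2))⁻¹ * (1 - t ^ 2) ^ ((q : ℝ) / 2 - 1)

/-- The measure `dF_q` on the line: density `projDensity q` on `[-1, 1]`, zero elsewhere. -/
def projLaw (q : ℕ) : Measure ℝ :=
  (volume.restrict (Set.Icc (-1) 1)).withDensity fun t => ENNReal.ofReal (projDensity q t)

/-- The projected uniform distribution function
`F_q(x) = B(1/2, q/2)⁻¹ ∫_{-1}^x (1 - t²)^(q/2 - 1) dt` for `x ∈ [-1, 1]`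
(and `0` to the left, `1` to the right of this interval). -/
def projCDF (q : ℕ) (x : ℝ) : ℝ := (projLaw q).real (Set.Iic x)

/-- The empirical distribution function `F_{n,γ}` of the projections `γ'X_1, …, γ'X_n`. -/
def projECDF {q n : ℕ} (X : Fin n → Omega q) (γ : Omega q) (x : ℝ) : ℝ :=
  (Nat.card {i : Fin n // inner ℝ (γ : EuclideanSpace ℝ (Fin (q + 1))) (X i) ≤ x} : ℝ) / n

/-- The weighted quadratic discrepancy
`Q_{n,q,γ}^w = n ∫_{-1}^1 (F_{n,γ}(x) - F_q(x))² w(F_q(x)) dF_q(x)` for a weight `w ≥ 0`,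
as an element of `[0, ∞]`. -/
def quadStat {q n : ℕ} (w : ℝ → ℝ) (X : Fin n → Omega q) (γ : Omega q) : ℝ≥0∞ :=
  n * ∫⁻ x, ENNReal.ofReal ((projECDF X γ x - projCDF q x) ^ 2 * w (projCDF q x)) ∂(projLaw q)

/-- The projected-ecdf statistic `P_{n,q}^w`: the expectation of `Q_{n,q,γ}^w` over `γ ∼ ν_q`. -/
def projStat {q n : ℕ} (w : ℝ → ℝ) (X : Fin n → Omega q) : ℝ≥0∞ :=
  ∫⁻ γ, quadStat w X γ ∂(uniformSphere q)

/-- The Anderson–Darling weight. -/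
def weightAD (u : ℝ) : ℝ := 1 / (u * (1 - u))

/-- The angle `θ_{ij} = arccos (X_i'X_j) ∈ [0, π]`. -/
def pairAngle {q n : ℕ} (X : Fin n → Omega q) (i j : Fin n) : ℝ :=
  Real.arccos (inner ℝ (X i : EuclideanSpace ℝ (Fin (q + 1))) (X j))

/-- The general integral expression of the Anderson–Darling kernel, for `q ≥ 2`:
`-log 4 + 4 ∫_0^{cos(θ/2)} log (F_q(t) / (1 - F_q(t)))
  (1 - F_{q-1}(t tan(θ/2) / (1 - t²)^{1/2})) dF_q(t)`. -/
def kernelADIntegral (q : ℕ) (θ : ℝ) : ℝ :=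
  -Real.log 4 + 4 * ∫ t in Set.Icc 0 (Real.cos (θ / 2)),
    Real.log (projCDF q t / (1 - projCDF q t)) *
      (1 - projCDF (q - 1) (t * Real.tan (θ / 2) / Real.sqrt (1 - t ^ 2))) ∂(projLaw q)

/-- The closed form for `q = 1`. -/
def kernelADOne (θ : ℝ) : ℝ :=
  -2 * Real.log (2 * Real.pi) + 1 / Real.pi *
    (θ * Real.log θ + (2 * Real.pi - θ) * Real.log (2 * Real.pi - θ))

/-- The expression for `q = 2`. -/
def kernelADTwo (θ : ℝ) : ℝ :=
  -Real.log 4 + 2 / Real.pi * ∫ t in (0 : ℝ)..Real.cos (θ / 2),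
    Real.log ((1 + t) / (1 - t)) *
      Real.arccos (t * Real.tan (θ / 2) / Real.sqrt (1 - t ^ 2))

/-- The expression for `q = 3`, with `s(θ) = θ - sin θ`. -/
def kernelADThree (θ : ℝ) : ℝ :=
  -2 * Real.log (2 * Real.pi) + 1 / Real.pi *
    ((θ - Real.sin θ) * Real.log (θ - Real.sin θ) +
      (2 * Real.pi - (θ - Real.sin θ)) * Real.log (2 * Real.pi - (θ - Real.sin θ))) -
    4 / Real.pi * Real.tan (θ / 2) * ∫ t in (0 : ℝ)..Real.cos (θ / 2),
      t * Real.log (Real.pi / (Real.arccos t - t * Real.sqrt (1 - t ^ 2)) - 1)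

/-- The kernel `ψ_q^AD` on `[0, π]`, with the convention `ψ_q^AD(0) = 0`. -/
def kernelAD (q : ℕ) (θ : ℝ) : ℝ :=
  if θ = 0 then 0
  else if q = 1 then kernelADOne θ
  else if q = 2 then kernelADTwo θ
  else if q = 3 then kernelADThree θ
  else kernelADIntegral q θ

end

end ProjectedECDF

namespace ProjectedECDF

/-! Fix a direction γ and put u_i = F_q(γ'X_i), the `score` of X_i. Substituting y = F_q(x)
(`measurePreserving_projCDF`) turns the inner integral into one over (0,1). Expanding the square
writes the statistic for γ as 1/n times a sum over pairs (i,j) of ∫ (1{u_i ≤ y} − y)(1{u_j ≤ y} −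
y)/(y(1 − y)) dy. This integral is elementary (`integral_pairIntegrand`): with u = u_i and v = u_j
it is −1 − logit(max(u,v)) − log(1 − u) − log(1 − v).

Now average over γ. Each score is uniform on (0,1), so log(1 − u) has mean −1 and a pair contributes
1 − E logit(max(u,v)). The diagonal terms have E logit(u) = 0. Hence the statistic is n plus 2/n
times the sum over i < j of −E logit(max(u_i,u_j)) (`projStat_toReal_eq`), and it remains to
identify this mean with minus the kernel.

Let a, b be the two projections and g = logit ∘ F_q, which is odd. Splitting by which projection is
larger and by its sign gives `logitCDF_max_eq`: g(max(a,b)) is g⁺(a) + g⁺(b) minus four terms of the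
form g(a)1{0 < a < b}, up to exchanging a and b and changing both signs. The law of (a,b) is
invariant under these operations, and g⁺ has mean log 2, so −E g(max(a,b)) = −log 4 + 4 E[g(a)1{0 <
a < b}] (`meanLogitMax_eq_wedge`).

Finally, for angle θ one may write b = a cos θ + √(1 − a²) w sin θ, with w independent of a and
distributed as a coordinate of a uniform point of the sphere one dimension lower
(`map_two_coords_uniformSphere`, `map_inner_pair_uniformSphere`). For 0 < θ < π and |t| < 1, given a
= t, the event a < b means w > t tan(θ/2)/√(1 − t²), which is almost surely impossible once t ≥
cos(θ/2). Conditioning on a gives the integral formula for q ≥ 2. For q = 1 the variable w is a fair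
sign and the integral is explicit; for q = 2, 3 explicit formulas for F_1, F_2, F_3 give the other
expressions. -/

variable {p q n : ℕ}

/-! ### Polar coordinates and slicing of the sphere -/

/-- Polar coordinates for the lower Lebesgue integral. -/
theorem lintegral_eq_lintegral_toSphere {E : Type*} [NormedAddCommGroup E] [NormedSpace ℝ E]
    [MeasurableSpace E] [BorelSpace E] [FiniteDimensional ℝ E] [Nontrivial E]
    (μ : Measure E) [μ.IsAddHaarMeasure] {f : E → ℝ≥0∞} (hf : Measurable f) :
    ∫⁻ z, f z ∂μ = ∫⁻ ω : Metric.sphere (0 : E) 1, (∫⁻ r in Set.Ioi (0 : ℝ),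
      ENNReal.ofReal (r ^ (Module.finrank ℝ E - 1)) * f (r • (ω : E))) ∂μ.toSphere := by
  have h0 : ∫⁻ z, f z ∂μ = ∫⁻ z in ({0}ᶜ : Set E), f z ∂μ := by
    rw [restrict_compl_singleton]
  have h1 := (μ.measurePreserving_homeomorphUnitSphereProd.symm
    (homeomorphUnitSphereProd E).toMeasurableEquiv).lintegral_comp
      (hf.comp measurable_subtype_coe)
  rw [h0, ← lintegral_subtype_comap (measurableSet_singleton _).compl]
  refine h1.symm.trans ?_
  rw [lintegral_prod]
  · refine lintegral_congr fun ω => ?_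
    rw [Measure.volumeIoiPow, lintegral_withDensity_eq_lintegral_mul]
    · rw [← lintegral_subtype_comap measurableSet_Ioi]
      rfl
    · fun_prop
    · refine hf.comp (measurable_subtype_coe.comp ?_)
      exact (MeasurableEquiv.measurable _).comp measurable_prodMk_left
  · exact ((hf.comp measurable_subtype_coe).comp (MeasurableEquiv.measurable _)).aemeasurable

/-- The point of `ℝ^(p+1)` with first coordinate `x` and remaining coordinates `z`. -/
noncomputable def consPoint (x : ℝ × EuclideanSpace ℝ (Fin p)) : EuclideanSpace ℝ (Fin (p + 1)) :=
  WithLp.toLp 2 (Fin.cons x.1 x.2.ofLp)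

@[simp] theorem consPoint_zero (x : ℝ × EuclideanSpace ℝ (Fin p)) : consPoint x 0 = x.1 := rfl

@[simp] theorem consPoint_succ (x : ℝ × EuclideanSpace ℝ (Fin p)) (i : Fin p) :
    consPoint x i.succ = x.2 i := rfl

theorem norm_consPoint_sq (x : ℝ × EuclideanSpace ℝ (Fin p)) :
    ‖consPoint x‖ ^ 2 = x.1 ^ 2 + ‖x.2‖ ^ 2 := by
  rw [EuclideanSpace.norm_sq_eq, EuclideanSpace.norm_sq_eq, Fin.sum_univ_succ]
  simp

theorem measurePreserving_consPoint :
    MeasurePreserving (consPoint (p := p)) (volume.prod volume) volume := by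
  have h1 : MeasurePreserving (Prod.map id (WithLp.ofLp (p := 2)) :
      ℝ × EuclideanSpace ℝ (Fin p) → ℝ × (Fin p → ℝ)) (volume.prod volume) volume :=
    (MeasurePreserving.id _).prod (PiLp.volume_preserving_ofLp (Fin p))
  have h2 := (volume_preserving_piFinSuccAbove (fun _ : Fin (p + 1) => ℝ) 0).symm
  have h3 := PiLp.volume_preserving_toLp (Fin (p + 1))
  have h4 : consPoint (p := p) = WithLp.toLp 2 ∘
      (MeasurableEquiv.piFinSuccAbove (fun _ : Fin (p + 1) => ℝ) 0).symm ∘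
        Prod.map id WithLp.ofLp := by
    ext x i
    refine Fin.cases ?_ (fun j => ?_) i <;> simp [consPoint, MeasurableEquiv.piFinSuccAbove]
  rw [h4]
  exact h3.comp (h2.comp h1)

theorem lintegral_consPoint {f : EuclideanSpace ℝ (Fin (p + 1)) → ℝ≥0∞} (hf : Measurable f) :
    ∫⁻ y, f y = ∫⁻ x : ℝ, ∫⁻ z : EuclideanSpace ℝ (Fin p), f (consPoint (x, z)) := by
  rw [← measurePreserving_consPoint.lintegral_comp hf, lintegral_prod]
  exact (hf.comp measurePreserving_consPoint.measurable).aemeasurable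

/-- The radial constant `∫_0^1 r^d dr`. -/
noncomputable def radialMass (d : ℕ) : ℝ≥0∞ :=
  ∫⁻ r in Set.Ioi (0 : ℝ), ENNReal.ofReal (r ^ d) * (Set.Iio (1 : ℝ)).indicator 1 r

theorem radialMass_eq (d : ℕ) :
    radialMass d = ∫⁻ r in Set.Ioo (0 : ℝ) 1, ENNReal.ofReal (r ^ d) := by
  rw [radialMass]
  have : (fun r : ℝ => ENNReal.ofReal (r ^ d) * (Set.Iio (1 : ℝ)).indicator (1 : ℝ → ℝ≥0∞) r) =
      (Set.Iio (1 : ℝ)).indicator fun r => ENNReal.ofReal (r ^ d) := by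
    ext r; by_cases h : r ∈ Set.Iio (1 : ℝ) <;> simp [h]
  rw [this, lintegral_indicator measurableSet_Iio, Measure.restrict_restrict measurableSet_Iio,
    Set.Iio_inter_Ioi]

theorem radialMass_ne_zero (d : ℕ) : radialMass d ≠ 0 := by
  rw [radialMass_eq]
  refine (setLIntegral_pos_iff (by fun_prop)).2 ?_ |>.ne'
  refine lt_of_lt_of_le ?_ (measure_mono (s := Set.Ioo (0 : ℝ) 1) ?_)
  · simp
  · intro r hr
    refine ⟨?_, hr⟩
    simp [pow_pos hr.1]

theorem radialMass_ne_top (d : ℕ) : radialMass d ≠ ⊤ := by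
  rw [radialMass_eq]
  refine ne_top_of_le_ne_top (b := ∫⁻ r in Set.Ioo (0 : ℝ) 1, 1) (by simp) ?_
  refine setLIntegral_mono measurable_const fun r hr => ?_
  rw [ENNReal.ofReal_le_one]
  exact pow_le_one₀ hr.1.le hr.2.le

/-- The integral over the unit ball of a function that depends on the direction only. -/
theorem lintegral_ball_direction {E : Type*} [NormedAddCommGroup E] [NormedSpace ℝ E]
    [MeasurableSpace E] [BorelSpace E] [FiniteDimensional ℝ E] [Nontrivial E]
    (μ : Measure E) [μ.IsAddHaarMeasure] {h : E → ℝ≥0∞} (hh : Measurable h) :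
    ∫⁻ z, (Set.Iio (1 : ℝ)).indicator 1 ‖z‖ * h (‖z‖⁻¹ • z) ∂μ =
      radialMass (Module.finrank ℝ E - 1) *
        ∫⁻ ω : Metric.sphere (0 : E) 1, h ω ∂μ.toSphere := by
  rw [lintegral_eq_lintegral_toSphere, ← lintegral_const_mul]
  · refine lintegral_congr fun ω => ?_
    rw [radialMass, ← lintegral_mul_const]
    · refine setLIntegral_congr_fun measurableSet_Ioi fun r hr => ?_
      have hr : 0 < r := hr
      have : ‖r • (ω : E)‖ = r := by simp [norm_smul, abs_of_pos hr]
      simp only [this]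
      rw [smul_smul, inv_mul_cancel₀ hr.ne', one_smul, mul_assoc]
    · refine (by fun_prop : Measurable fun r : ℝ => ENNReal.ofReal _).mul
        (measurable_one.indicator measurableSet_Iio)
  · exact hh.comp measurable_subtype_coe
  · refine ((measurable_one.indicator measurableSet_Iio).comp measurable_norm).mul
      (hh.comp (by fun_prop))

/-- The slice formula with an angular coordinate. -/
theorem lintegral_toSphere_slice_angle {h : ℝ × ℝ → ℝ≥0∞} (hh : Measurable h) :
    ∫⁻ γ : Omega (p + 1), h ((γ : EuclideanSpace ℝ (Fin (p + 2))) 0,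
        (γ : EuclideanSpace ℝ (Fin (p + 2))) 1) ∂(volume.toSphere) =
      ∫⁻ ω : Omega p, (∫⁻ α in Set.Ioo 0 Real.pi, ENNReal.ofReal (Real.sin α ^ p) *
        h (Real.cos α, Real.sin α * (ω : EuclideanSpace ℝ (Fin (p + 1))) 0))
          ∂(volume.toSphere) := by
  have hC0 := radialMass_ne_zero (p + 1)
  have hC1 := radialMass_ne_top (p + 1)
  -- Multiplying by the radial mass replaces the surface integral by a volume integral over the unit
  -- ball, where Fubini is available.
  rw [← ENNReal.mul_right_inj hC0 hC1]
  set H : EuclideanSpace ℝ (Fin (p + 2)) → ℝ≥0∞ := fun x => h (x 0, x 1) with hH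
  have hHm : Measurable H := hh.comp (by fun_prop)
  have hball := lintegral_ball_direction
    (volume : Measure (EuclideanSpace ℝ (Fin (p + 2)))) hHm
  have hdim : Module.finrank ℝ (EuclideanSpace ℝ (Fin (p + 2))) - 1 = p + 1 := by simp
  rw [hdim] at hball
  rw [← hball]
  set f : EuclideanSpace ℝ (Fin (p + 2)) → ℝ≥0∞ :=
    fun z => (Set.Iio (1 : ℝ)).indicator 1 ‖z‖ * H (‖z‖⁻¹ • z) with hf
  have hfm : Measurable f :=
    ((measurable_one.indicator measurableSet_Iio).comp measurable_norm).mul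
      (hHm.comp (by fun_prop))
  have hcons : Measurable (consPoint (p := p + 1)) := measurePreserving_consPoint.measurable
  rw [lintegral_consPoint hfm, ← lintegral_const_mul]
  rotate_left
  · refine Measurable.lintegral_prod_right' (f := fun x : Omega p × ℝ =>
      ENNReal.ofReal (Real.sin x.2 ^ p) *
        h (Real.cos x.2, Real.sin x.2 * (x.1 : EuclideanSpace ℝ (Fin (p + 1))) 0)) ?_
    refine Measurable.mul (by fun_prop) (hh.comp (by fun_prop))
  have step1 : ∀ x : ℝ, ∫⁻ z : EuclideanSpace ℝ (Fin (p + 1)), f (consPoint (x, z)) =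
      ∫⁻ ω : Omega p, (∫⁻ r in Set.Ioi (0 : ℝ),
        ENNReal.ofReal (r ^ p) * f (consPoint (x, r • (ω : EuclideanSpace ℝ (Fin (p + 1))))))
        ∂(volume.toSphere) := by
    intro x
    rw [lintegral_eq_lintegral_toSphere]
    · simp
    · exact hfm.comp (hcons.comp measurable_prodMk_left)
  simp_rw [step1]
  rw [lintegral_lintegral_swap]
  rotate_left
  · refine (Measurable.lintegral_prod_right' (f := fun x : (ℝ × Omega p) × ℝ =>
      ENNReal.ofReal (x.2 ^ p) *
        f (consPoint (x.1.1, x.2 • (x.1.2 : EuclideanSpace ℝ (Fin (p + 1)))))) ?_).aemeasurable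
    refine Measurable.mul (by fun_prop) (hfm.comp (hcons.comp (by fun_prop)))
  refine lintegral_congr fun ω => ?_
  have hω : ‖(ω : EuclideanSpace ℝ (Fin (p + 1)))‖ = 1 := by simp
  have step2 : ∫⁻ x : ℝ, ∫⁻ r in Set.Ioi (0 : ℝ),
        ENNReal.ofReal (r ^ p) * f (consPoint (x, r • (ω : EuclideanSpace ℝ (Fin (p + 1))))) =
      ∫⁻ y : ℝ × ℝ, (Set.Ioi (0 : ℝ)).indicator 1 y.2 * (ENNReal.ofReal (y.2 ^ p) *
        f (consPoint (y.1, y.2 • (ω : EuclideanSpace ℝ (Fin (p + 1)))))) := by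
    rw [Measure.volume_eq_prod, lintegral_prod]
    · refine lintegral_congr fun x => ?_
      rw [← lintegral_indicator measurableSet_Ioi]
      refine lintegral_congr fun r => ?_
      by_cases hr : r ∈ Set.Ioi (0 : ℝ) <;> simp [hr]
    · refine Measurable.aemeasurable ?_
      refine ((measurable_one.indicator measurableSet_Ioi).comp measurable_snd).mul ?_
      exact Measurable.mul (by fun_prop) (hfm.comp (hcons.comp (by fun_prop)))
  -- With ω fixed, (x, r) runs over a half plane; its polar coordinates have as radius the norm of
  -- the whole point and as angle the colatitude α.
  rw [step2, ← lintegral_comp_polarCoord_symm]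
  have step3 : ∀ y ∈ polarCoord.target, ENNReal.ofReal y.1 •
      ((Set.Ioi (0 : ℝ)).indicator 1 (polarCoord.symm y).2 *
        (ENNReal.ofReal ((polarCoord.symm y).2 ^ p) *
        f (consPoint ((polarCoord.symm y).1,
          (polarCoord.symm y).2 • (ω : EuclideanSpace ℝ (Fin (p + 1))))))) =
      (ENNReal.ofReal (y.1 ^ (p + 1)) * (Set.Iio (1 : ℝ)).indicator 1 y.1) *
      ((Set.Ioo 0 Real.pi).indicator (fun α => ENNReal.ofReal (Real.sin α ^ p) *
        h (Real.cos α, Real.sin α * (ω : EuclideanSpace ℝ (Fin (p + 1))) 0)) y.2) := by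
    rintro ⟨r, α⟩ ⟨hr, hα⟩
    have hr : 0 < r := hr
    simp only [polarCoord_symm_apply]
    by_cases hα0 : 0 < α
    · have hs : 0 < Real.sin α := Real.sin_pos_of_pos_of_lt_pi hα0 hα.2
      have hmem : r * Real.sin α ∈ Set.Ioi (0 : ℝ) := mul_pos hr hs
      have hmem' : α ∈ Set.Ioo 0 Real.pi := ⟨hα0, hα.2⟩
      have hn : ‖consPoint (r * Real.cos α,
          (r * Real.sin α) • (ω : EuclideanSpace ℝ (Fin (p + 1))))‖ = r := by
        rw [← sq_eq_sq₀ (norm_nonneg _) hr.le, norm_consPoint_sq, norm_smul, hω, mul_one,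
          Real.norm_eq_abs, sq_abs]
        linear_combination r ^ 2 * Real.sin_sq_add_cos_sq α
      rw [Set.indicator_of_mem hmem, Set.indicator_of_mem hmem']
      simp only [hf, hH, hn, PiLp.smul_apply, consPoint_zero, smul_eq_mul]
      have h1 : consPoint (r * Real.cos α,
          (r * Real.sin α) • (ω : EuclideanSpace ℝ (Fin (p + 1)))) 1 =
          r * Real.sin α * (ω : EuclideanSpace ℝ (Fin (p + 1))) 0 := rfl
      rw [h1, mul_assoc r, inv_mul_cancel_left₀ hr.ne', inv_mul_cancel_left₀ hr.ne',
        mul_pow, ENNReal.ofReal_mul (by positivity), pow_succ' r, ENNReal.ofReal_mul hr.le]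
      simp only [Pi.one_apply]
      ring
    · have hs : Real.sin α ≤ 0 := Real.sin_nonpos_of_nonpos_of_neg_pi_le (not_lt.1 hα0) hα.1.le
      have hmem : r * Real.sin α ∉ Set.Ioi (0 : ℝ) :=
        not_lt.2 (mul_nonpos_of_nonneg_of_nonpos hr.le hs)
      have hmem' : α ∉ Set.Ioo 0 Real.pi := fun h => hα0 h.1
      rw [Set.indicator_of_notMem hmem, Set.indicator_of_notMem hmem']
      simp
  -- The integrand is now a product of a radial and an angular factor, and the radial one integrates
  -- to the mass introduced at the start.
  rw [setLIntegral_congr_fun polarCoord.open_target.measurableSet step3]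
  change ∫⁻ y in Set.Ioi (0 : ℝ) ×ˢ Set.Ioo (-Real.pi) Real.pi, _ ∂(volume.prod volume) = _
  rw [← Measure.prod_restrict, lintegral_prod_mul
    (f := fun r : ℝ => ENNReal.ofReal (r ^ (p + 1)) * (Set.Iio (1 : ℝ)).indicator 1 r)
    (g := (Set.Ioo 0 Real.pi).indicator (fun α => ENNReal.ofReal (Real.sin α ^ p) *
      h (Real.cos α, Real.sin α * (ω : EuclideanSpace ℝ (Fin (p + 1))) 0)))]
  · rw [lintegral_indicator measurableSet_Ioo, Measure.restrict_restrict measurableSet_Ioo,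
      Set.inter_eq_left.2 (Set.Ioo_subset_Ioo_left (by linarith [Real.pi_pos]))]
    rfl
  · exact (Measurable.mul (by fun_prop)
      (measurable_one.indicator measurableSet_Iio)).aemeasurable
  · refine Measurable.aemeasurable (Measurable.indicator ?_ measurableSet_Ioo)
    exact Measurable.mul (by fun_prop) (hh.comp (by fun_prop))

/-! ### The law of one projection -/

theorem measurable_projDensity (q : ℕ) : Measurable (projDensity q) := by
  unfold projDensity; fun_prop

theorem projDensity_neg (q : ℕ) (t : ℝ) : projDensity q (-t) = projDensity q t := by
  simp [projDensity]

theorem projBeta_pos (hq : 1 ≤ q) : 0 < ProbabilityTheory.beta (1 / 2) ((q : ℝ) / 2) :=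
  ProbabilityTheory.beta_pos (by norm_num) (by positivity)

theorem projDensity_pos (hq : 1 ≤ q) {t : ℝ} (ht : t ∈ Set.Ioo (-1 : ℝ) 1) :
    0 < projDensity q t := by
  have : 0 < 1 - t ^ 2 := by nlinarith [ht.1, ht.2]
  exact mul_pos (inv_pos.2 (projBeta_pos hq)) (Real.rpow_pos_of_pos this _)

theorem projDensity_nonneg (hq : 1 ≤ q) {t : ℝ} (ht : t ∈ Set.Icc (-1 : ℝ) 1) :
    0 ≤ projDensity q t := by
  have : 0 ≤ 1 - t ^ 2 := by nlinarith [ht.1, ht.2]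
  exact mul_nonneg (inv_pos.2 (projBeta_pos hq)).le (Real.rpow_nonneg this _)

theorem projLaw_eq_Ioo (q : ℕ) : projLaw q =
    (volume.restrict (Set.Ioo (-1) 1)).withDensity fun t => ENNReal.ofReal (projDensity q t) := by
  rw [projLaw, Measure.restrict_congr_set Ioo_ae_eq_Icc]

theorem lintegral_projLaw (q : ℕ) {f : ℝ → ℝ≥0∞} (hf : Measurable f) :
    ∫⁻ t, f t ∂(projLaw q) =
      ∫⁻ t in Set.Ioo (-1 : ℝ) 1, ENNReal.ofReal (projDensity q t) * f t := by
  rw [projLaw_eq_Ioo, lintegral_withDensity_eq_lintegral_mul _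
    (measurable_projDensity q).ennreal_ofReal hf]
  rfl

theorem projLaw_absolutelyContinuous (q : ℕ) : projLaw q ≪ volume :=
  (withDensity_absolutelyContinuous _ _).trans Measure.restrict_le_self.absolutelyContinuous

instance (q : ℕ) : NullSingletonClass (projLaw q) := by
  refine ⟨fun x => projLaw_absolutelyContinuous q (measure_singleton x)⟩

theorem ae_projLaw_mem_Ioo (q : ℕ) : ∀ᵐ t ∂(projLaw q), t ∈ Set.Ioo (-1 : ℝ) 1 := by
  rw [projLaw_eq_Ioo]
  exact (withDensity_absolutelyContinuous _ _).ae_le (ae_restrict_mem measurableSet_Ioo)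

theorem setLIntegral_Ioo_neg {f : ℝ → ℝ≥0∞} (a b : ℝ) :
    ∫⁻ t in Set.Ioo a b, f (-t) = ∫⁻ t in Set.Ioo (-b) (-a), f t := by
  rw [← (Measure.measurePreserving_neg (volume : Measure ℝ)).setLIntegral_comp_preimage_emb
    (MeasurableEquiv.neg ℝ).measurableEmbedding]
  simp

/-- By evenness the mass is twice that of (0, 1), and x = t² carries this to the total mass of the
Beta(1/2, q/2) law. -/
theorem projLaw_univ (hq : 1 ≤ q) : projLaw q Set.univ = 1 := by
  have hB := projBeta_pos hq
  set D : ℝ → ℝ≥0∞ := fun t => ENNReal.ofReal (projDensity q t) with hD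
  have h1 : projLaw q Set.univ = ∫⁻ t in Set.Ioo (-1 : ℝ) 1, D t := by
    rw [projLaw_eq_Ioo, withDensity_apply _ .univ, Measure.restrict_univ]
  have h2 : ∫⁻ t in Set.Ioo (-1 : ℝ) 1, D t = 2 * ∫⁻ t in Set.Ioo (0 : ℝ) 1, D t := by
    have : Set.Ioo (-1 : ℝ) 1 =ᵐ[volume] (Set.Ioo (-1 : ℝ) 0 ∪ Set.Ioo 0 1 : Set ℝ) := by
      have h3 : (Set.Ioo (-1 : ℝ) 0 ∪ Set.Ioo 0 1 : Set ℝ) = Set.Ioo (-1 : ℝ) 1 \ {0} := by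
        ext x
        simp only [Set.mem_union, Set.mem_Ioo, Set.mem_sdiff, Set.mem_singleton_iff]
        constructor
        · rintro (h | h)
          · exact ⟨⟨h.1, by linarith⟩, h.2.ne⟩
          · exact ⟨⟨by linarith, h.2⟩, h.1.ne'⟩
        · rintro ⟨h, h0⟩
          rcases lt_or_gt_of_ne h0 with h0 | h0
          · exact .inl ⟨h.1, h0⟩
          · exact .inr ⟨h0, h.2⟩
      rw [h3]
      exact (sdiff_null_ae_eq_self (measure_singleton _)).symm
    rw [setLIntegral_congr this, lintegral_union measurableSet_Ioo, two_mul]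
    · congr 1
      have := setLIntegral_Ioo_neg (f := D) 0 1
      rw [neg_zero] at this
      rw [← this]
      simp only [hD, projDensity_neg]
    · rw [Set.disjoint_left]
      rintro x hx hx'
      exact absurd hx.2 hx'.1.not_gt
  have h3 := ProbabilityTheory.lintegral_betaPDF_eq_one (α := 1 / 2) (β := (q : ℝ) / 2)
    (by norm_num) (by positivity)
  rw [ProbabilityTheory.lintegral_betaPDF] at h3
  have himg : (fun t : ℝ => t ^ 2) '' Set.Ioo 0 1 = Set.Ioo 0 1 := by
    ext x
    constructor
    · rintro ⟨t, ht, rfl⟩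
      exact ⟨by have := ht.1; positivity, by nlinarith [ht.1, ht.2]⟩
    · intro hx
      refine ⟨√x, ⟨Real.sqrt_pos.2 hx.1, ?_⟩, Real.sq_sqrt hx.1.le⟩
      rw [Real.sqrt_lt' one_pos]; simpa using hx.2
  rw [← himg, lintegral_image_eq_lintegral_abs_deriv_mul (f' := fun t => 2 * t) measurableSet_Ioo]
    at h3
  · rw [h1, h2, ← h3, ← lintegral_const_mul _ (measurable_projDensity q).ennreal_ofReal]
    refine setLIntegral_congr_fun measurableSet_Ioo fun t ht => ?_
    have ht0 : 0 < t := ht.1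
    simp only [projDensity]
    rw [← ENNReal.ofReal_mul (by positivity), ← ENNReal.ofReal_ofNat 2,
      ← ENNReal.ofReal_mul (by norm_num)]
    congr 1
    rw [abs_of_pos (by positivity), ← Real.rpow_natCast t 2, ← Real.rpow_mul ht0.le,
      show ((2 : ℕ) : ℝ) * (1 / 2 - 1) = -1 by norm_num, Real.rpow_neg_one]
    field_simp
  · intro t _
    simpa using (hasDerivAt_pow 2 t).hasDerivWithinAt
  · intro x hx y hy hxy
    exact (pow_left_inj₀ hx.1.le hy.1.le two_ne_zero).1 hxy

theorem isProbabilityMeasure_projLaw (hq : 1 ≤ q) : IsProbabilityMeasure (projLaw q) :=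
  ⟨projLaw_univ hq⟩

instance (p : ℕ) : IsProbabilityMeasure (projLaw (p + 1)) :=
  isProbabilityMeasure_projLaw (Nat.le_add_left 1 p)

theorem measurePreserving_neg_projLaw (q : ℕ) :
    MeasurePreserving (fun t : ℝ => -t) (projLaw q) (projLaw q) := by
  refine ⟨measurable_neg, Measure.ext_of_lintegral _ fun f hf => ?_⟩
  rw [lintegral_map hf measurable_neg,
    lintegral_projLaw q (f := fun t => f (-t)) (hf.comp measurable_neg),
    lintegral_projLaw q hf]
  have := setLIntegral_Ioo_neg (f := fun t => ENNReal.ofReal (projDensity q t) * f t) (-1) 1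
  rw [neg_neg] at this
  rw [← this]
  simp [projDensity_neg]

instance (q : ℕ) : IsProbabilityMeasure (uniformSphere q) := by
  refine ⟨?_⟩
  rw [uniformSphere, Measure.smul_apply, smul_eq_mul, ENNReal.inv_mul_cancel]
  · exact Measure.measure_univ_ne_zero.2 (Measure.toSphere_ne_zero _)
  · exact measure_ne_top _ _

/-! ### The joint law of two coordinates -/

/-- The substitution `t = cos α` on `(0, π)`. -/
theorem lintegral_cos_sub {f : ℝ → ℝ → ℝ≥0∞} (p : ℕ) :
    ∫⁻ α in Set.Ioo 0 Real.pi, ENNReal.ofReal (Real.sin α ^ p) *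
        f (Real.cos α) (Real.sin α) =
      ∫⁻ t in Set.Ioo (-1 : ℝ) 1, ENNReal.ofReal ((1 - t ^ 2) ^ (((p + 1 : ℕ) : ℝ) / 2 - 1)) *
        f t √(1 - t ^ 2) := by
  have himg : Real.cos '' Set.Ioo 0 Real.pi = Set.Ioo (-1) 1 := by
    ext x
    constructor
    · rintro ⟨α, hα, rfl⟩
      have h1 := Real.strictAntiOn_cos (Set.left_mem_Icc.2 Real.pi_pos.le)
        ⟨hα.1.le, hα.2.le⟩ hα.1
      have h2 := Real.strictAntiOn_cos ⟨hα.1.le, hα.2.le⟩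
        (Set.right_mem_Icc.2 Real.pi_pos.le) hα.2
      simp only [Real.cos_zero, Real.cos_pi] at h1 h2
      exact ⟨h2, h1⟩
    · intro hx
      refine ⟨Real.arccos x, ⟨Real.arccos_pos.2 hx.2, ?_⟩, Real.cos_arccos hx.1.le hx.2.le⟩
      exact lt_of_le_of_ne (Real.arccos_le_pi x)
        fun h => absurd (Real.arccos_eq_pi.1 h) (not_le.2 hx.1)
  rw [← himg, lintegral_image_eq_lintegral_abs_deriv_mul (f' := fun α => -Real.sin α)
    measurableSet_Ioo]
  · refine setLIntegral_congr_fun measurableSet_Ioo fun α hα => ?_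
    have hs : 0 < Real.sin α := Real.sin_pos_of_pos_of_lt_pi hα.1 hα.2
    have h1 : 1 - Real.cos α ^ 2 = Real.sin α ^ 2 := by rw [Real.sin_sq]
    simp only [h1, Real.sqrt_sq hs.le, abs_neg, abs_of_pos hs]
    rw [← mul_assoc, ← ENNReal.ofReal_mul hs.le]
    congr 2
    rw [← Real.rpow_natCast (Real.sin α) 2, ← Real.rpow_mul hs.le, ← Real.rpow_natCast,
      show ∀ y : ℝ, Real.sin α * Real.sin α ^ y = Real.sin α ^ (1 + y) from
        fun y => by rw [Real.rpow_add hs, Real.rpow_one]]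
    congr 1; push_cast; ring
  · intro t _
    exact (Real.hasDerivAt_cos t).hasDerivWithinAt
  · exact Real.injOn_cos.mono Set.Ioo_subset_Icc_self

/-- The law of the first coordinate of a uniform point of `Ω_p`. -/
noncomputable def coordLaw (p : ℕ) : Measure ℝ :=
  (uniformSphere p).map fun γ : Omega p => (γ : EuclideanSpace ℝ (Fin (p + 1))) 0

theorem measurable_coord (p : ℕ) (i : Fin (p + 1)) :
    Measurable fun γ : Omega p => (γ : EuclideanSpace ℝ (Fin (p + 1))) i := by fun_prop

instance (p : ℕ) : IsProbabilityMeasure (coordLaw p) :=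
  Measure.isProbabilityMeasure_map (measurable_coord p 0).aemeasurable

/-- The joint law of the first two coordinates of a uniform point of the sphere. -/
theorem map_two_coords_uniformSphere (p : ℕ) :
    (uniformSphere (p + 1)).map (fun γ : Omega (p + 1) => ((γ : EuclideanSpace ℝ (Fin (p + 2))) 0,
        (γ : EuclideanSpace ℝ (Fin (p + 2))) 1)) =
      ((projLaw (p + 1)).prod (coordLaw p)).map fun y => (y.1, √(1 - y.1 ^ 2) * y.2) := by
  set S1 : Measure (Omega (p + 1)) := Measure.toSphere volume with hS1
  set S0 : Measure (Omega p) := Measure.toSphere volume with hS0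
  have hm1 : Measurable fun γ : Omega (p + 1) => ((γ : EuclideanSpace ℝ (Fin (p + 2))) 0,
        (γ : EuclideanSpace ℝ (Fin (p + 2))) 1) := by fun_prop
  have hm2 : Measurable fun y : ℝ × ℝ => (y.1, √(1 - y.1 ^ 2) * y.2) := by fun_prop
  have hB := projBeta_pos (Nat.le_add_left 1 p)
  set B : ℝ≥0∞ := ENNReal.ofReal (ProbabilityTheory.beta (1 / 2) (((p + 1 : ℕ) : ℝ) / 2)) with hBd
  -- No surface area is computed: this constant collects all normalizations, and it must be 1
  -- because both laws are probability measures.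
  set c : ℝ≥0∞ := (S1 Set.univ)⁻¹ * B * S0 Set.univ with hc
  have hS0u : S0 Set.univ ≠ 0 := Measure.measure_univ_ne_zero.2 (Measure.toSphere_ne_zero _)
  have hS0t : S0 Set.univ ≠ ⊤ := measure_ne_top _ _
  have key : (uniformSphere (p + 1)).map (fun γ : Omega (p + 1) =>
      ((γ : EuclideanSpace ℝ (Fin (p + 2))) 0,
        (γ : EuclideanSpace ℝ (Fin (p + 2))) 1)) =
      c • ((projLaw (p + 1)).prod (coordLaw p)).map fun y => (y.1, √(1 - y.1 ^ 2) * y.2) := by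
    refine Measure.ext_of_lintegral _ fun h hh => ?_
    have e1 : ∫⁻ ω : Omega p, (∫⁻ α in Set.Ioo 0 Real.pi, ENNReal.ofReal (Real.sin α ^ p) *
        h (Real.cos α, Real.sin α * (ω : EuclideanSpace ℝ (Fin (p + 1))) 0)) ∂S0 =
        B * ∫⁻ ω : Omega p, (∫⁻ t, h (t, √(1 - t ^ 2) *
          (ω : EuclideanSpace ℝ (Fin (p + 1))) 0) ∂(projLaw (p + 1))) ∂S0 := by
      rw [← lintegral_const_mul']
      · refine lintegral_congr fun ω => ?_
        rw [lintegral_cos_sub (f := fun a b => h (a, b * (ω : EuclideanSpace ℝ (Fin (p + 1))) 0)),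
          lintegral_projLaw _ (f := fun t => h (t, √(1 - t ^ 2) *
            (ω : EuclideanSpace ℝ (Fin (p + 1))) 0)) (hh.comp (by fun_prop)),
          ← lintegral_const_mul']
        · refine lintegral_congr fun t => ?_
          rw [← mul_assoc, hBd, ← ENNReal.ofReal_mul hB.le, projDensity,
            mul_inv_cancel_left₀ hB.ne']
        · exact ENNReal.ofReal_ne_top
      · exact ENNReal.ofReal_ne_top
    have e2 : ∫⁻ ω : Omega p, (∫⁻ t, h (t, √(1 - t ^ 2) *
          (ω : EuclideanSpace ℝ (Fin (p + 1))) 0) ∂(projLaw (p + 1))) ∂S0 =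
        S0 Set.univ * ∫⁻ w, ∫⁻ t, h (t, √(1 - t ^ 2) * w) ∂(projLaw (p + 1)) ∂(coordLaw p) := by
      have hmm : Measurable fun w : ℝ => ∫⁻ t, h (t, √(1 - t ^ 2) * w) ∂(projLaw (p + 1)) :=
        Measurable.lintegral_prod_right' (f := fun x : ℝ × ℝ => h (x.2, √(1 - x.2 ^ 2) * x.1))
          (hh.comp (by fun_prop))
      rw [coordLaw, lintegral_map hmm (measurable_coord p 0), uniformSphere, lintegral_smul_measure,
        smul_eq_mul, ← mul_assoc, ENNReal.mul_inv_cancel hS0u hS0t, one_mul]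
    rw [lintegral_map hh hm1, lintegral_smul_measure, lintegral_map hh hm2, uniformSphere,
      lintegral_smul_measure, lintegral_toSphere_slice_angle hh, e1, e2,
      lintegral_prod_symm' (fun y : ℝ × ℝ => h (y.1, √(1 - y.1 ^ 2) * y.2)) (hh.comp hm2), hc]
    simp only [smul_eq_mul, mul_assoc]
    rfl
  have hc1 : c = 1 := by
    have h1 := congrArg (fun m => m Set.univ) key
    have := Measure.isProbabilityMeasure_map (μ := uniformSphere (p + 1)) hm1.aemeasurable
    have := Measure.isProbabilityMeasure_map (μ := (projLaw (p + 1)).prod (coordLaw p))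
      hm2.aemeasurable
    simpa using h1.symm
  rw [key, hc1, one_smul]

/-- First marginal of the two-coordinate formula. The shift matters: `coordLaw 0` is a two-point law
without density, so the coordinate law is kept separate from `projLaw`. -/
theorem coordLaw_succ (p : ℕ) : coordLaw (p + 1) = projLaw (p + 1) := by
  have h := congrArg (fun m => m.map Prod.fst) (map_two_coords_uniformSphere p)
  simp only at h
  rw [Measure.map_map measurable_fst (by fun_prop), Measure.map_map measurable_fst (by fun_prop)]
    at h
  calc coordLaw (p + 1) = _ := h
    _ = ((projLaw (p + 1)).prod (coordLaw p)).map Prod.fst := rfl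
    _ = projLaw (p + 1) := by simp [Measure.map_fst_prod]

/-! ### The distribution function and the probability integral transform -/

theorem monotone_projCDF (hq : 1 ≤ q) : Monotone (projCDF q) := by
  have := isProbabilityMeasure_projLaw hq
  exact fun x y hxy => measureReal_mono (Set.Iic_subset_Iic.2 hxy)

theorem continuous_projCDF (hq : 1 ≤ q) : Continuous (projCDF q) := by
  have := isProbabilityMeasure_projLaw hq
  have h := intervalIntegral.continuous_primitive (μ := projLaw q) (f := fun _ => (1 : ℝ))
    (fun a b => intervalIntegrable_const) 0
  have h2 : projCDF q = fun b => (∫ x in (0 : ℝ)..b, (1 : ℝ) ∂(projLaw q)) + projCDF q 0 := by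
    ext b
    rw [intervalIntegral.integral_const_of_cdf]
    simp [projCDF]
  rw [h2]
  exact h.add continuous_const

theorem projCDF_nonneg (x : ℝ) : 0 ≤ projCDF q x := measureReal_nonneg

theorem projCDF_le_one (hq : 1 ≤ q) (x : ℝ) : projCDF q x ≤ 1 := by
  have := isProbabilityMeasure_projLaw hq
  exact measureReal_le_one

theorem projCDF_neg (hq : 1 ≤ q) (x : ℝ) : projCDF q (-x) = 1 - projCDF q x := by
  have := isProbabilityMeasure_projLaw hq
  have h1 : projCDF q (-x) = (projLaw q).real (Set.Ici x) := by
    rw [projCDF, measureReal_def, ← (measurePreserving_neg_projLaw q).measure_preimage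
      measurableSet_Iic.nullMeasurableSet, measureReal_def]
    simp
  rw [h1, measureReal_congr Ioi_ae_eq_Ici.symm, ← Set.compl_Iic,
    probReal_compl_eq_one_sub measurableSet_Iic, projCDF]

theorem projCDF_zero (hq : 1 ≤ q) : projCDF q 0 = 1 / 2 := by
  have := projCDF_neg hq 0
  rw [neg_zero] at this
  linarith

theorem projCDF_of_one_le (hq : 1 ≤ q) {x : ℝ} (hx : 1 ≤ x) : projCDF q x = 1 := by
  have := isProbabilityMeasure_projLaw hq
  rw [projCDF, measureReal_def, (mem_ae_iff_prob_eq_one measurableSet_Iic).1]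
  · rfl
  · filter_upwards [ae_projLaw_mem_Ioo q] with t ht using ht.2.le.trans hx

theorem projCDF_neg_one (hq : 1 ≤ q) : projCDF q (-1) = 0 := by
  rw [projCDF_neg hq, projCDF_of_one_le hq le_rfl, sub_self]

theorem strictMonoOn_projCDF (hq : 1 ≤ q) : StrictMonoOn (projCDF q) (Set.Icc (-1) 1) := by
  have := isProbabilityMeasure_projLaw hq
  intro x hx y hy hxy
  have h1 : projLaw q (Set.Ioo x y) ≠ 0 := by
    have hsub : Set.Ioo x y ⊆ Set.Ioo (-1) 1 := Set.Ioo_subset_Ioo hx.1 hy.2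
    rw [projLaw_eq_Ioo, withDensity_apply _ measurableSet_Ioo,
      Measure.restrict_restrict measurableSet_Ioo, Set.inter_eq_left.2 hsub]
    refine ((setLIntegral_pos_iff (measurable_projDensity q).ennreal_ofReal).2 ?_).ne'
    refine lt_of_lt_of_le ?_ (measure_mono (s := Set.Ioo x y) ?_)
    · simp [hxy]
    · intro r hr
      refine ⟨?_, hr⟩
      simp [projDensity_pos hq (hsub hr)]
  have h2 : projCDF q y = projCDF q x + (projLaw q).real (Set.Ioc x y) := by
    rw [projCDF, projCDF, ← Set.Iic_union_Ioc_eq_Iic hxy.le,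
      measureReal_union (Set.Iic_disjoint_Ioc le_rfl) measurableSet_Ioc]
  have h3 : 0 < (projLaw q).real (Set.Ioc x y) := by
    rw [measureReal_congr Ioo_ae_eq_Ioc.symm, measureReal_def]
    exact ENNReal.toReal_pos h1 (measure_ne_top _ _)
  linarith

theorem projCDF_mem_Ioo (hq : 1 ≤ q) {x : ℝ} (hx : x ∈ Set.Ioo (-1 : ℝ) 1) :
    projCDF q x ∈ Set.Ioo (0 : ℝ) 1 := by
  have h := strictMonoOn_projCDF hq
  have h1 := h (Set.left_mem_Icc.2 (by norm_num)) (Set.Ioo_subset_Icc_self hx) hx.1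
  have h2 := h (Set.Ioo_subset_Icc_self hx) (Set.right_mem_Icc.2 (by norm_num)) hx.2
  rw [projCDF_neg_one hq] at h1
  rw [projCDF_of_one_le hq le_rfl] at h2
  exact ⟨h1, h2⟩

/-- The probability integral transform for the projected uniform law. -/
theorem measurePreserving_projCDF (hq : 1 ≤ q) :
    MeasurePreserving (projCDF q) (projLaw q) (volume.restrict (Set.Ioo 0 1)) := by
  have := isProbabilityMeasure_projLaw hq
  have hm : Measurable (projCDF q) := (continuous_projCDF hq).measurable
  refine ⟨hm, ?_⟩
  have := Measure.isProbabilityMeasure_map (μ := projLaw q) hm.aemeasurable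
  refine Measure.ext_of_Iic _ _ fun a => ?_
  rw [Measure.map_apply hm measurableSet_Iic, Measure.restrict_apply measurableSet_Iic]
  rcases lt_or_ge a 0 with ha | ha
  · have h1 : projCDF q ⁻¹' Set.Iic a = ∅ := by
      ext x
      simp only [Set.mem_preimage, Set.mem_Iic, Set.mem_empty_iff_false, iff_false, not_le]
      exact ha.trans_le (projCDF_nonneg x)
    have h2 : Set.Iic a ∩ Set.Ioo 0 1 = ∅ := by
      ext x
      simp only [Set.mem_inter_iff, Set.mem_Iic, Set.mem_Ioo, Set.mem_empty_iff_false, iff_false]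
      rintro ⟨h, h', -⟩
      linarith
    simp [h1, h2]
  rcases le_or_gt 1 a with ha1 | ha1
  · have h1 : projCDF q ⁻¹' Set.Iic a = Set.univ :=
      Set.eq_univ_of_forall fun x => (projCDF_le_one hq x).trans ha1
    have h2 : Set.Iic a ∩ Set.Ioo 0 1 = Set.Ioo (0 : ℝ) 1 :=
      Set.inter_eq_right.2 fun x hx => hx.2.le.trans ha1
    simp [h1, h2]
  -- Continuity supplies a quantile x with F_q(x) = a; strict monotonicity makes the preimage of
  -- (−∞, a] equal to (−∞, x] up to a null set.
  · obtain ⟨x, hx, hxa⟩ : a ∈ projCDF q '' Set.Icc (-1) 1 := by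
      refine intermediate_value_Icc (by norm_num) (continuous_projCDF hq).continuousOn ?_
      rw [projCDF_neg_one hq, projCDF_of_one_le hq le_rfl]
      exact ⟨ha, ha1.le⟩
    have h1 : (projCDF q ⁻¹' Set.Iic a : Set ℝ) =ᵐ[projLaw q] Set.Iic x := by
      filter_upwards [ae_projLaw_mem_Ioo q] with t ht
      refine propext ?_
      change projCDF q t ≤ a ↔ t ≤ x
      rw [← hxa, (strictMonoOn_projCDF hq).le_iff_le (Set.Ioo_subset_Icc_self ht) hx]
    have h2 : Set.Iic a ∩ Set.Ioo 0 1 = Set.Ioc 0 a := by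
      ext y
      simp only [Set.mem_inter_iff, Set.mem_Iic, Set.mem_Ioo, Set.mem_Ioc]
      constructor
      · rintro ⟨h, h', -⟩; exact ⟨h', h⟩
      · rintro ⟨h, h'⟩; exact ⟨h', h, h'.trans_lt ha1⟩
    have h3 : (projLaw q).real (Set.Iic x) = a := hxa
    rw [measure_congr h1, h2, Real.volume_Ioc, sub_zero, ← h3, ofReal_measureReal]

/-- Change of variables `y = F_q(x)` on an interval. -/
theorem setIntegral_comp_projCDF (hq : 1 ≤ q) {φ : ℝ → ℝ} (hφ : Measurable φ) {a b : ℝ}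
    (ha : -1 ≤ a) (hab : a ≤ b) (hb : b ≤ 1) :
    ∫ x in Set.Icc a b, φ (projCDF q x) ∂(projLaw q) =
      ∫ y in projCDF q a..projCDF q b, φ y := by
  have hmp := measurePreserving_projCDF hq
  have hA : a ∈ Set.Icc (-1 : ℝ) 1 := ⟨ha, hab.trans hb⟩
  have hB : b ∈ Set.Icc (-1 : ℝ) 1 := ⟨ha.trans hab, hb⟩
  have h1 : (Set.Icc a b : Set ℝ) =ᵐ[projLaw q]
      (projCDF q ⁻¹' Set.Icc (projCDF q a) (projCDF q b) : Set ℝ) := by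
    filter_upwards [ae_projLaw_mem_Ioo q] with t ht
    refine propext ?_
    change (a ≤ t ∧ t ≤ b) ↔ (projCDF q a ≤ projCDF q t ∧ projCDF q t ≤ projCDF q b)
    rw [(strictMonoOn_projCDF hq).le_iff_le (Set.Ioo_subset_Icc_self ht) hB,
      (strictMonoOn_projCDF hq).le_iff_le hA (Set.Ioo_subset_Icc_self ht)]
  rw [setIntegral_congr_set h1, ← setIntegral_map measurableSet_Icc
    hφ.aestronglyMeasurable hmp.measurable.aemeasurable, hmp.map_eq,
    Measure.restrict_restrict measurableSet_Icc,
    intervalIntegral.integral_of_le (monotone_projCDF hq hab)]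
  refine setIntegral_congr_set ?_
  have h2 : (Set.Icc (projCDF q a) (projCDF q b) ∩ Set.Icc 0 1 : Set ℝ) =
      Set.Icc (projCDF q a) (projCDF q b) :=
    Set.inter_eq_left.2 fun y hy =>
      ⟨(projCDF_nonneg a).trans hy.1, hy.2.trans (projCDF_le_one hq b)⟩
  refine (Filter.EventuallyEq.inter (Filter.EventuallyEq.refl (ae volume)
    (Set.Icc (projCDF q a) (projCDF q b))) (Ioo_ae_eq_Icc (a := (0 : ℝ)) (b := 1))).trans ?_
  rw [h2]
  exact Ioc_ae_eq_Icc.symm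

/-! ### The logit and its integrals -/

/-- The logit function. -/
noncomputable def logit (u : ℝ) : ℝ := Real.log (u / (1 - u))

theorem measurable_logit : Measurable logit := by unfold logit; fun_prop

theorem logit_eq {u : ℝ} (h0 : u ≠ 0) (h1 : u ≠ 1) :
    logit u = Real.log u - Real.log (1 - u) := by
  rw [logit, Real.log_div h0 (sub_ne_zero.2 h1.symm)]

theorem logit_one_sub {u : ℝ} (h0 : u ≠ 0) (h1 : u ≠ 1) : logit (1 - u) = -logit u := by
  rw [logit_eq h0 h1, logit_eq (sub_ne_zero.2 h1.symm) (by simpa using h0), sub_sub_cancel]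
  ring

theorem logit_ae_eq : logit =ᵐ[volume] fun u => Real.log u - Real.log (1 - u) := by
  have h : ({0, 1} : Set ℝ)ᶜ ∈ ae (volume : Measure ℝ) :=
    compl_mem_ae_iff.2 ((Set.toFinite _).measure_zero _)
  filter_upwards [h] with u hu
  simp only [Set.mem_compl_iff, Set.mem_insert_iff, Set.mem_singleton_iff, not_or] at hu
  exact logit_eq hu.1 hu.2

theorem intervalIntegrable_log_one_sub (a b : ℝ) :
    IntervalIntegrable (fun u => Real.log (1 - u)) volume a b := by
  have := (intervalIntegral.intervalIntegrable_log' (a := 1 - a) (b := 1 - b)).comp_sub_left 1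
  simpa using this

theorem intervalIntegrable_logit (a b : ℝ) : IntervalIntegrable logit volume a b := by
  refine (intervalIntegral.intervalIntegrable_log'.sub
    (intervalIntegrable_log_one_sub a b)).congr_ae ?_
  exact ae_restrict_of_ae (logit_ae_eq.mono fun x hx => hx.symm)

theorem integral_log_one_sub (a b : ℝ) : ∫ u in a..b, Real.log (1 - u) =
    (1 - a) * Real.log (1 - a) - (1 - b) * Real.log (1 - b) + a - b := by
  rw [intervalIntegral.integral_comp_sub_left (fun u => Real.log u) 1, integral_log]
  ring

/-- The primitive is the negative entropy. No restriction on the endpoints is needed, since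
`Real.log` is log |·| with value 0 at 0. -/
theorem integral_logit (a b : ℝ) : ∫ u in a..b, logit u =
    b * Real.log b + (1 - b) * Real.log (1 - b) -
      (a * Real.log a + (1 - a) * Real.log (1 - a)) := by
  rw [intervalIntegral.integral_congr_ae (logit_ae_eq.mono fun x hx _ => hx),
    intervalIntegral.integral_sub intervalIntegral.intervalIntegrable_log'
      (intervalIntegrable_log_one_sub a b), integral_log, integral_log_one_sub]
  ring

theorem integrableOn_Ioo_of_intervalIntegrable {f : ℝ → ℝ} {a b : ℝ} (hab : a ≤ b)
    (hf : IntervalIntegrable f volume a b) : IntegrableOn f (Set.Ioo a b) :=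
  ((intervalIntegrable_iff_integrableOn_Ioc_of_le hab).1 hf).mono_set Set.Ioo_subset_Ioc_self

/-- The logit of the projected uniform distribution function. -/
noncomputable def logitCDF (q : ℕ) (t : ℝ) : ℝ := logit (projCDF q t)

theorem measurable_logitCDF (hq : 1 ≤ q) : Measurable (logitCDF q) :=
  measurable_logit.comp (continuous_projCDF hq).measurable

theorem integrable_logitCDF (hq : 1 ≤ q) : Integrable (logitCDF q) (projLaw q) :=
  (measurePreserving_projCDF hq).integrable_comp_of_integrable
    (integrableOn_Ioo_of_intervalIntegrable zero_le_one (intervalIntegrable_logit 0 1))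

theorem integral_logitCDF (hq : 1 ≤ q) {a b : ℝ} (ha : -1 ≤ a) (hab : a ≤ b) (hb : b ≤ 1) :
    ∫ t in Set.Icc a b, logitCDF q t ∂(projLaw q) =
      projCDF q b * Real.log (projCDF q b) +
        (1 - projCDF q b) * Real.log (1 - projCDF q b) -
      (projCDF q a * Real.log (projCDF q a) +
        (1 - projCDF q a) * Real.log (1 - projCDF q a)) := by
  rw [← integral_logit]
  exact setIntegral_comp_projCDF hq measurable_logit ha hab hb

theorem integral_logitCDF_zero (hq : 1 ≤ q) {b : ℝ} (h0 : 0 ≤ b) (hb : b ≤ 1) :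
    ∫ t in Set.Icc 0 b, logitCDF q t ∂(projLaw q) =
      projCDF q b * Real.log (projCDF q b) +
        (1 - projCDF q b) * Real.log (1 - projCDF q b) + Real.log 2 := by
  rw [integral_logitCDF hq (by norm_num) h0 hb, projCDF_zero hq,
    show (1 : ℝ) - 1 / 2 = 1 / 2 by norm_num,
    one_div, Real.log_inv]
  ring

theorem integral_logitCDF_Ioi (hq : 1 ≤ q) :
    ∫ t in Set.Ioi 0, logitCDF q t ∂(projLaw q) = Real.log 2 := by
  have h : (Set.Ioi 0 : Set ℝ) =ᵐ[projLaw q] Set.Icc 0 1 := by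
    refine Ioi_ae_eq_Ici.trans ?_
    filter_upwards [ae_projLaw_mem_Ioo q] with t ht
    refine propext ?_
    change 0 ≤ t ↔ 0 ≤ t ∧ t ≤ 1
    simp [ht.2.le]
  rw [setIntegral_congr_set h, integral_logitCDF_zero hq zero_le_one le_rfl,
    projCDF_of_one_le hq le_rfl]
  simp

theorem logitCDF_neg (hq : 1 ≤ q) {t : ℝ} (ht : t ∈ Set.Ioo (-1 : ℝ) 1) :
    logitCDF q (-t) = -logitCDF q t := by
  have h := projCDF_mem_Ioo hq ht
  rw [logitCDF, projCDF_neg hq, logit_one_sub h.1.ne' h.2.ne, logitCDF]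

/-- Evaluation of `F_q` through an antiderivative of its density. -/
theorem projCDF_eq_of_hasDerivAt (hq : 1 ≤ q) {G : ℝ → ℝ} (hc : ContinuousOn G (Set.Icc (-1) 1))
    (hG : G (-1) = 0) (hd : ∀ t ∈ Set.Ioo (-1 : ℝ) 1, HasDerivAt G (projDensity q t) t)
    {x : ℝ} (hx : x ∈ Set.Icc (-1 : ℝ) 1) : projCDF q x = G x := by
  -- Integrability comes from the total mass being 1; for q = 1 the density is unbounded near ±1, so
  -- continuity would not do.
  have hint : IntegrableOn (projDensity q) (Set.Icc (-1) 1) := by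
    refine ⟨(measurable_projDensity q).aestronglyMeasurable, ?_⟩
    rw [hasFiniteIntegral_iff_ofReal]
    · have h := projLaw_univ hq
      rw [projLaw, withDensity_apply _ .univ, Measure.restrict_univ] at h
      rw [h]
      exact ENNReal.one_lt_top
    · exact (ae_restrict_mem measurableSet_Icc).mono fun t ht => projDensity_nonneg hq ht
  have hsub : Set.Icc (-1 : ℝ) x ⊆ Set.Icc (-1) 1 := Set.Icc_subset_Icc_right hx.2
  have h1 : projCDF q x = ∫ t in Set.Icc (-1) x, projDensity q t := by
    rw [integral_eq_lintegral_of_nonneg_ae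
      ((ae_restrict_mem measurableSet_Icc).mono fun t ht => projDensity_nonneg hq (hsub ht))
      (measurable_projDensity q).aestronglyMeasurable, projCDF, measureReal_def, projLaw,
      withDensity_apply _ measurableSet_Iic, Measure.restrict_restrict measurableSet_Iic]
    congr 3
    ext t
    simp only [Set.mem_inter_iff, Set.mem_Iic, Set.mem_Icc]
    constructor
    · rintro ⟨h, h', -⟩; exact ⟨h', h⟩
    · rintro ⟨h, h'⟩; exact ⟨h', h, h'.trans hx.2⟩
  rw [h1, integral_Icc_eq_integral_Ioc, ← intervalIntegral.integral_of_le hx.1,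
    intervalIntegral.integral_eq_sub_of_hasDerivAt_of_le hx.1 (hc.mono hsub)
      (fun t ht => hd t ⟨ht.1, ht.2.trans_le hx.2⟩), hG, sub_zero]
  rw [intervalIntegrable_iff_integrableOn_Icc_of_le hx.1]
  exact hint.mono_set hsub

/-! ### The Anderson–Darling energy of a pair of scores -/

/-- Integration of a function that has a `C¹` antiderivative on the closed interval and may take
other values at the endpoints. -/
theorem integral_eq_sub_of_eqOn_Ioo {f g G : ℝ → ℝ} {a b : ℝ} (hab : a ≤ b)
    (hfg : ∀ x ∈ Set.Ioo a b, g x = f x) (hc : ContinuousOn g (Set.Icc a b))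
    (hd : ∀ x ∈ Set.Icc a b, HasDerivAt G (g x) x) :
    IntervalIntegrable f volume a b ∧ ∫ x in a..b, f x = G b - G a := by
  have hg : IntervalIntegrable g volume a b := hc.intervalIntegrable_of_Icc hab
  refine ⟨?_, ?_⟩
  · rw [intervalIntegrable_iff_integrableOn_Ioo_of_le hab] at hg ⊢
    exact hg.congr_fun hfg measurableSet_Ioo
  · rw [← intervalIntegral.integral_eq_sub_of_hasDerivAt (by rwa [Set.uIcc_of_le hab]) hg,
      intervalIntegral.integral_of_le hab, intervalIntegral.integral_of_le hab,
      integral_Ioc_eq_integral_Ioo, integral_Ioc_eq_integral_Ioo]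
    exact setIntegral_congr_fun measurableSet_Ioo fun x hx => (hfg x hx).symm

/-- The Anderson–Darling integrand attached to a pair of uniform scores. -/
noncomputable def pairIntegrand (u v y : ℝ) : ℝ :=
  ((if u ≤ y then 1 else 0) - y) * ((if v ≤ y then 1 else 0) - y) * weightAD y

/-- The integral of `pairIntegrand u v` over `(0, 1)`. -/
noncomputable def pairEnergy (u v : ℝ) : ℝ :=
  -1 - logit (max u v) - Real.log (1 - u) - Real.log (1 - v)

theorem pairIntegrand_comm (u v y : ℝ) : pairIntegrand u v y = pairIntegrand v u y := by
  rw [pairIntegrand, pairIntegrand, mul_comm (_ - y)]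

theorem pairEnergy_comm (u v : ℝ) : pairEnergy u v = pairEnergy v u := by
  rw [pairEnergy, pairEnergy, max_comm]; ring

/-- The weight cancels on each of (0,u), (u,v), (v,1), leaving y/(1 − y), −1 and (1 − y)/y. The
apparent singularities at 0 and 1 are gone, and the three integrals add up to −1 − log(1 − u) − log
v. -/
theorem integral_pairIntegrand_of_le {u v : ℝ} (hu : 0 < u) (huv : u ≤ v) (hv : v < 1) :
    IntegrableOn (pairIntegrand u v) (Set.Ioo 0 1) ∧
      ∫ y in Set.Ioo 0 1, pairIntegrand u v y = pairEnergy u v := by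
  obtain ⟨i1, e1⟩ := integral_eq_sub_of_eqOn_Ioo (f := pairIntegrand u v)
    (g := fun y => y / (1 - y)) (G := fun y => -y - Real.log (1 - y)) hu.le
    (fun y hy => by
      have h1 : ¬ u ≤ y := not_le.2 hy.2
      have h2 : ¬ v ≤ y := not_le.2 (hy.2.trans_le huv)
      have h3 : y ≠ 0 := hy.1.ne'
      have h4 : 1 - y ≠ 0 := by linarith [hy.2]
      simp only [pairIntegrand, h1, h2, if_false, weightAD]
      field_simp
      ring)
    (by
      refine continuousOn_id.div (continuousOn_const.sub continuousOn_id) fun y hy => ?_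
      have : y ≤ u := hy.2
      exact (sub_pos.2 (this.trans_lt (huv.trans_lt hv))).ne')
    (fun y hy => by
      have h4 : 1 - y ≠ 0 := by linarith [hy.2]
      have := (hasDerivAt_id y).neg.sub (((hasDerivAt_id y).const_sub 1).log h4)
      refine this.congr_deriv ?_
      simp only [id]
      field_simp
      ring)
  obtain ⟨i2, e2⟩ := integral_eq_sub_of_eqOn_Ioo (f := pairIntegrand u v)
    (g := fun y => -1) (G := fun y => -y) huv
    (fun y hy => by
      have h1 : u ≤ y := hy.1.le
      have h2 : ¬ v ≤ y := not_le.2 hy.2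
      have h3 : y ≠ 0 := by linarith [hy.1]
      have h4 : 1 - y ≠ 0 := by linarith [hy.2]
      simp only [pairIntegrand, h1, h2, if_false, if_true, weightAD]
      field_simp
      ring)
    continuousOn_const
    (fun y _ => (hasDerivAt_id y).neg)
  obtain ⟨i3, e3⟩ := integral_eq_sub_of_eqOn_Ioo (f := pairIntegrand u v)
    (g := fun y => (1 - y) / y) (G := fun y => Real.log y - y) hv.le
    (fun y hy => by
      have h1 : u ≤ y := huv.trans hy.1.le
      have h2 : v ≤ y := hy.1.le
      have h3 : y ≠ 0 := by linarith [hy.1]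
      have h4 : 1 - y ≠ 0 := by linarith [hy.2]
      simp only [pairIntegrand, h1, h2, if_true, weightAD]
      field_simp)
    (by
      refine (continuousOn_const.sub continuousOn_id).div continuousOn_id fun y hy => ?_
      have : v ≤ y := hy.1
      exact (hu.trans_le (huv.trans this)).ne')
    (fun y hy => by
      have h3 : y ≠ 0 := by linarith [hy.1]
      refine ((Real.hasDerivAt_log h3).sub (hasDerivAt_id y)).congr_deriv ?_
      field_simp)
  have i12 := i1.trans i2
  refine ⟨integrableOn_Ioo_of_intervalIntegrable zero_le_one (i12.trans i3), ?_⟩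
  rw [← integral_Ioc_eq_integral_Ioo, ← intervalIntegral.integral_of_le zero_le_one,
    ← intervalIntegral.integral_add_adjacent_intervals i12 i3,
    ← intervalIntegral.integral_add_adjacent_intervals i1 i2, e1, e2, e3, pairEnergy,
    max_eq_right huv, logit_eq (by linarith) hv.ne]
  simp
  ring

theorem integral_pairIntegrand {u v : ℝ} (hu : u ∈ Set.Ioo (0 : ℝ) 1) (hv : v ∈ Set.Ioo (0 : ℝ) 1) :
    IntegrableOn (pairIntegrand u v) (Set.Ioo 0 1) ∧
      ∫ y in Set.Ioo 0 1, pairIntegrand u v y = pairEnergy u v := by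
  rcases le_total u v with h | h
  · exact integral_pairIntegrand_of_le hu.1 h hv.2
  · have := integral_pairIntegrand_of_le hv.1 h hu.2
    rw [pairEnergy_comm]
    have h2 : pairIntegrand u v = pairIntegrand v u := funext (pairIntegrand_comm u v)
    rwa [h2]

theorem projECDF_eq (X : Fin n → Omega q) (γ : Omega q) (x : ℝ) :
    projECDF X γ x = (∑ i : Fin n,
      if inner ℝ (γ : EuclideanSpace ℝ (Fin (q + 1))) (X i) ≤ x then (1 : ℝ) else 0) / n := by
  classical
  rw [projECDF, Nat.card_eq_fintype_card, Fintype.card_subtype, Finset.sum_boole]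

/-- The score of the projection of `x` in the direction `γ`. -/
noncomputable def score (x γ : Omega q) : ℝ :=
  projCDF q (inner ℝ (γ : EuclideanSpace ℝ (Fin (q + 1))) x)

theorem sum_pairIntegrand (hn : 1 ≤ n) (s : Fin n → ℝ) (y : ℝ) :
    n * (((∑ i, if s i ≤ y then (1 : ℝ) else 0) / n - y) ^ 2 * weightAD y) =
      (n : ℝ)⁻¹ * ∑ i, ∑ j, pairIntegrand (s i) (s j) y := by
  have hn0 : (n : ℝ) ≠ 0 := by positivity
  have h : (∑ i, if s i ≤ y then (1 : ℝ) else 0) / n - y =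
      (n : ℝ)⁻¹ * ∑ i, ((if s i ≤ y then (1 : ℝ) else 0) - y) := by
    rw [Finset.sum_sub_distrib]
    simp only [Finset.sum_const, Finset.card_univ, Fintype.card_fin, nsmul_eq_mul]
    field_simp
  simp only [pairIntegrand]
  rw [h, mul_pow, sq (Finset.sum _ _), Finset.sum_mul_sum]
  simp only [← Finset.sum_mul]
  field_simp

/-- The quadratic statistic for a fixed direction with projections inside `(-1, 1)`. -/
theorem quadStat_eq (hq : 1 ≤ q) (hn : 1 ≤ n) (X : Fin n → Omega q) (γ : Omega q)
    (hγ : ∀ i, inner ℝ (γ : EuclideanSpace ℝ (Fin (q + 1))) (X i) ∈ Set.Ioo (-1 : ℝ) 1) :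
    quadStat weightAD X γ =
        ENNReal.ofReal ((n : ℝ)⁻¹ * ∑ i, ∑ j, pairEnergy (score (X i) γ) (score (X j) γ)) ∧
      0 ≤ (n : ℝ)⁻¹ * ∑ i, ∑ j, pairEnergy (score (X i) γ) (score (X j) γ) := by
  have hs : ∀ i, score (X i) γ ∈ Set.Ioo (0 : ℝ) 1 := fun i => projCDF_mem_Ioo hq (hγ i)
  set Φ : ℝ → ℝ := fun y =>
    (n : ℝ)⁻¹ * ∑ i, ∑ j, pairIntegrand (score (X i) γ) (score (X j) γ) y with hΦ
  have hΦm : Measurable Φ := by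
    have hw : Measurable weightAD := by unfold weightAD; fun_prop
    have hi : ∀ u : ℝ, Measurable fun y : ℝ => if u ≤ y then (1 : ℝ) else 0 := fun u =>
      Measurable.ite measurableSet_Ici measurable_const measurable_const
    refine (Finset.measurable_sum _ fun i _ => Finset.measurable_sum _ fun j _ => ?_).const_mul _
    exact (((hi _).sub measurable_id).mul ((hi _).sub measurable_id)).mul hw
  have hΦi : IntegrableOn Φ (Set.Ioo 0 1) :=
    (integrable_finsetSum _ fun i _ => integrable_finsetSum _ fun j _ =>
      (integral_pairIntegrand (hs i) (hs j)).1).const_mul _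
  have hΦe : ∫ y in Set.Ioo 0 1, Φ y =
      (n : ℝ)⁻¹ * ∑ i, ∑ j, pairEnergy (score (X i) γ) (score (X j) γ) := by
    rw [integral_const_mul, integral_finsetSum _ fun i _ => integrable_finsetSum _ fun j _ =>
      (integral_pairIntegrand (hs i) (hs j)).1]
    congr 1
    refine Finset.sum_congr rfl fun i _ => ?_
    rw [integral_finsetSum _ fun j _ => (integral_pairIntegrand (hs i) (hs j)).1]
    exact Finset.sum_congr rfl fun j _ => (integral_pairIntegrand (hs i) (hs j)).2
  have hΦ0 : ∀ y ∈ Set.Ioo (0 : ℝ) 1, 0 ≤ Φ y := by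
    intro y hy
    simp only [hΦ]
    rw [← sum_pairIntegrand hn]
    have : 0 ≤ weightAD y :=
      one_div_nonneg.2 (mul_nonneg hy.1.le (sub_nonneg.2 hy.2.le))
    positivity
  have hΦ0' : 0 ≤ᵐ[volume.restrict (Set.Ioo 0 1)] Φ :=
    (ae_restrict_mem measurableSet_Ioo).mono hΦ0
  rw [← hΦe]
  refine ⟨?_, integral_nonneg_of_ae hΦ0'⟩
  rw [ofReal_integral_eq_lintegral_ofReal hΦi hΦ0',
    ← (measurePreserving_projCDF hq).lintegral_comp hΦm.ennreal_ofReal, quadStat,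
    ← lintegral_const_mul' _ _ (ENNReal.natCast_ne_top n)]
  refine lintegral_congr_ae ?_
  filter_upwards [ae_projLaw_mem_Ioo q] with x hx
  rw [← ENNReal.ofReal_natCast, ← ENNReal.ofReal_mul (Nat.cast_nonneg n)]
  congr 1
  simp only [hΦ]
  rw [← sum_pairIntegrand hn, projECDF_eq]
  -- Strict monotonicity of F_q on [−1, 1] turns the empirical distribution function of the
  -- projections at x into that of the scores at F_q(x).
  have h : ∀ i, (inner ℝ (γ : EuclideanSpace ℝ (Fin (q + 1))) (X i) ≤ x) ↔
      score (X i) γ ≤ projCDF q x := fun i =>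
    ((strictMonoOn_projCDF hq).le_iff_le (Set.Ioo_subset_Icc_self (hγ i))
      (Set.Ioo_subset_Icc_self hx)).symm
  simp only [h]

/-! ### Rotation invariance and the laws of projections -/

/-- The uniform law on the sphere, as a law on the ambient space, is invariant under isometries. -/
theorem map_isometry_uniformSphere
    (A : EuclideanSpace ℝ (Fin (q + 1)) ≃ₗᵢ[ℝ] EuclideanSpace ℝ (Fin (q + 1))) :
    (uniformSphere q).map (fun γ : Omega q => A (γ : EuclideanSpace ℝ (Fin (q + 1)))) =
      (uniformSphere q).map (fun γ : Omega q => (γ : EuclideanSpace ℝ (Fin (q + 1)))) := by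
  have hA : Measurable A := A.continuous.measurable
  refine Measure.ext_of_lintegral _ fun h hh => ?_
  have hAc : Measurable fun γ : Omega q => A (γ : EuclideanSpace ℝ (Fin (q + 1))) :=
    hA.comp measurable_subtype_coe
  rw [lintegral_map hh hAc, lintegral_map hh measurable_subtype_coe,
    uniformSphere, lintegral_smul_measure, lintegral_smul_measure]
  congr 1
  have h1 := lintegral_ball_direction (volume : Measure (EuclideanSpace ℝ (Fin (q + 1)))) hh
  have h2 := lintegral_ball_direction (volume : Measure (EuclideanSpace ℝ (Fin (q + 1))))
    (hh.comp hA)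
  -- Passing to the ball reduces the claim to invariance of Lebesgue measure under `A`.
  rw [← ENNReal.mul_right_inj (radialMass_ne_zero _) (radialMass_ne_top _)]
  refine h2.symm.trans (Eq.trans ?_ h1)
  refine Eq.trans ?_ (A.measurePreserving.lintegral_comp
    (((measurable_one.indicator measurableSet_Iio).comp measurable_norm).mul
      (hh.comp (by fun_prop))))
  refine lintegral_congr fun z => ?_
  simp only [Function.comp, A.norm_map, map_smul]

theorem measurable_inner_sphere (x : EuclideanSpace ℝ (Fin (q + 1))) :
    Measurable fun γ : Omega q => inner ℝ (γ : EuclideanSpace ℝ (Fin (q + 1))) x := by fun_prop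

/-- The coordinates of a uniform point have the same law in every orthonormal basis. -/
theorem map_basis_uniformSphere
    (b : OrthonormalBasis (Fin (q + 1)) ℝ (EuclideanSpace ℝ (Fin (q + 1))))
    {β : Type*} [MeasurableSpace β] {f : EuclideanSpace ℝ (Fin (q + 1)) → β} (hf : Measurable f) :
    (uniformSphere q).map (fun γ : Omega q => f (b.repr (γ : EuclideanSpace ℝ (Fin (q + 1))))) =
      (uniformSphere q).map (fun γ : Omega q => f (γ : EuclideanSpace ℝ (Fin (q + 1)))) := by
  have h := congrArg (fun m => m.map f) (map_isometry_uniformSphere b.repr)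
  have hb : Measurable fun γ : Omega q => b.repr (γ : EuclideanSpace ℝ (Fin (q + 1))) :=
    b.repr.continuous.measurable.comp measurable_subtype_coe
  rwa [Measure.map_map hf hb, Measure.map_map hf measurable_subtype_coe] at h

theorem norm_omega (x : Omega q) : ‖(x : EuclideanSpace ℝ (Fin (q + 1)))‖ = 1 := by simp

/-- A unit vector is the first vector of an orthonormal basis. -/
theorem exists_basis_zero (x : Omega q) :
    ∃ b : OrthonormalBasis (Fin (q + 1)) ℝ (EuclideanSpace ℝ (Fin (q + 1))), b 0 = x := by
  have ho : Orthonormal ℝ (({0} : Set (Fin (q + 1))).domRestrict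
      fun _ => (x : EuclideanSpace ℝ (Fin (q + 1)))) := by
    refine ⟨fun i => norm_omega x, fun i j hij => ?_⟩
    exact absurd (Subsingleton.elim i j) hij
  obtain ⟨b, hb⟩ := ho.exists_orthonormalBasis_extension_of_card_eq (by simp)
  exact ⟨b, hb 0 rfl⟩

/-- Two unit vectors lie in the plane of the first two vectors of an orthonormal basis. -/
theorem exists_basis_pair (x y : Omega (p + 1)) :
    ∃ b : OrthonormalBasis (Fin (p + 2)) ℝ (EuclideanSpace ℝ (Fin (p + 2))), b 0 = x ∧
      (y : EuclideanSpace ℝ (Fin (p + 2))) =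
        Real.cos (Real.arccos (inner ℝ (x : EuclideanSpace ℝ (Fin (p + 2))) y)) • b 0 +
        Real.sin (Real.arccos (inner ℝ (x : EuclideanSpace ℝ (Fin (p + 2))) y)) • b 1 := by
  set c : ℝ := inner ℝ (x : EuclideanSpace ℝ (Fin (p + 2))) y with hc
  have hcabs : |c| ≤ 1 := by
    have := abs_real_inner_le_norm (x : EuclideanSpace ℝ (Fin (p + 2))) y
    simpa using this
  rw [Real.cos_arccos (abs_le.1 hcabs).1 (abs_le.1 hcabs).2, Real.sin_arccos]
  set z : EuclideanSpace ℝ (Fin (p + 2)) := (y : EuclideanSpace ℝ (Fin (p + 2))) - c • x with hz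
  have hxx : inner ℝ (x : EuclideanSpace ℝ (Fin (p + 2))) x = (1 : ℝ) := by
    rw [real_inner_self_eq_norm_sq, norm_omega]; norm_num
  have hxz : inner ℝ (x : EuclideanSpace ℝ (Fin (p + 2))) z = (0 : ℝ) := by
    rw [hz, inner_sub_right, inner_smul_right, hxx, ← hc]; ring
  have hznorm : ‖z‖ = √(1 - c ^ 2) := by
    have h1 : ‖z‖ ^ 2 = 1 - c ^ 2 := by
      rw [hz, norm_sub_sq_real, inner_smul_right, norm_smul, norm_omega, norm_omega,
        real_inner_comm, ← hc, Real.norm_eq_abs, mul_one, sq_abs]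
      ring
    rw [← h1, Real.sqrt_sq (norm_nonneg _)]
  -- Gram–Schmidt, with z the component of y orthogonal to x. If z = 0 then y = ±x, and the second
  -- basis vector is arbitrary because its coefficient vanishes.
  by_cases hz0 : z = 0
  · obtain ⟨b, hb⟩ := exists_basis_zero x
    refine ⟨b, hb, ?_⟩
    rw [← hznorm, hz0, norm_zero, zero_smul, add_zero, hb]
    exact sub_eq_zero.1 hz0
  · have hzn : ‖z‖ ≠ 0 := norm_ne_zero_iff.2 hz0
    set v : Fin (p + 2) → EuclideanSpace ℝ (Fin (p + 2)) :=
      fun i => if i = 0 then x else ‖z‖⁻¹ • z with hv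
    have ho : Orthonormal ℝ (({0, 1} : Set (Fin (p + 2))).domRestrict v) := by
      have hn : ∀ i, ‖v i‖ = 1 := by
        intro i
        simp only [hv]
        split_ifs
        · exact norm_omega x
        · rw [norm_smul, norm_inv, norm_norm, inv_mul_cancel₀ hzn]
      refine ⟨fun i => hn i, ?_⟩
      rintro ⟨i, hi⟩ ⟨j, hj⟩ hij
      have h10 : (1 : Fin (p + 2)) ≠ 0 := by simp
      rcases hi with rfl | rfl <;> rcases hj with rfl | rfl
      · exact absurd rfl hij
      · change inner ℝ (v 0) (v 1) = (0 : ℝ)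
        simp [hv, inner_smul_right, hxz]
      · change inner ℝ (v 1) (v 0) = (0 : ℝ)
        rw [real_inner_comm]
        simp [hv, inner_smul_right, hxz]
      · exact absurd rfl hij
    obtain ⟨b, hb⟩ := ho.exists_orthonormalBasis_extension_of_card_eq (by simp)
    have hb0 : b 0 = x := by rw [hb 0 (by simp)]; simp [hv]
    have hb1 : b 1 = ‖z‖⁻¹ • z := by rw [hb 1 (by simp)]; simp [hv]
    refine ⟨b, hb0, ?_⟩
    rw [hb0, hb1, ← hznorm, smul_smul, mul_inv_cancel₀ hzn, one_smul, hz]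
    abel

theorem map_inner_uniformSphere (x : Omega q) :
    (uniformSphere q).map (fun γ : Omega q => inner ℝ (γ : EuclideanSpace ℝ (Fin (q + 1))) x) =
      coordLaw q := by
  obtain ⟨b, hb⟩ := exists_basis_zero x
  rw [coordLaw, ← map_basis_uniformSphere b (f := fun z => z 0) (by fun_prop)]
  congr 1
  ext γ
  rw [b.repr_apply_apply, hb, real_inner_comm]

/-- In a basis adapted to x and y only the first two coordinates of γ enter. In particular the law
depends on the points through their angle alone. -/
theorem map_inner_pair_uniformSphere (x y : Omega (p + 1)) {θ : ℝ}
    (hθ : Real.arccos (inner ℝ (x : EuclideanSpace ℝ (Fin (p + 2))) y) = θ) :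
    (uniformSphere (p + 1)).map (fun γ : Omega (p + 1) =>
        (inner ℝ (γ : EuclideanSpace ℝ (Fin (p + 2))) x,
          inner ℝ (γ : EuclideanSpace ℝ (Fin (p + 2))) y)) =
      ((projLaw (p + 1)).prod (coordLaw p)).map fun t =>
        (t.1, Real.cos θ * t.1 + Real.sin θ * (√(1 - t.1 ^ 2) * t.2)) := by
  obtain ⟨b, hb, hy⟩ := exists_basis_pair x y
  rw [hθ] at hy
  have h := congrArg (fun m => m.map fun t : ℝ × ℝ => (t.1, Real.cos θ * t.1 + Real.sin θ * t.2))
    (map_two_coords_uniformSphere p)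
  simp only at h
  rw [Measure.map_map (by fun_prop) (by fun_prop), Measure.map_map (by fun_prop) (by fun_prop)]
    at h
  refine Eq.trans ?_ h
  refine Eq.trans ?_ (map_basis_uniformSphere b
    (f := fun z => (z 0, Real.cos θ * z 0 + Real.sin θ * z 1)) (by fun_prop))
  congr 1
  ext γ
  · simp only [b.repr_apply_apply, hb]
    rw [real_inner_comm]
  · simp only [b.repr_apply_apply]
    conv_lhs => rw [hy]
    rw [inner_add_right, inner_smul_right, inner_smul_right, real_inner_comm, real_inner_comm (b 1)]

theorem map_neg_pair_uniformSphere (x y : EuclideanSpace ℝ (Fin (q + 1))) :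
    (uniformSphere q).map (fun γ : Omega q =>
        (-inner ℝ (γ : EuclideanSpace ℝ (Fin (q + 1))) x,
          -inner ℝ (γ : EuclideanSpace ℝ (Fin (q + 1))) y)) =
      (uniformSphere q).map (fun γ : Omega q =>
        (inner ℝ (γ : EuclideanSpace ℝ (Fin (q + 1))) x,
          inner ℝ (γ : EuclideanSpace ℝ (Fin (q + 1))) y)) := by
  have h := congrArg (fun m => m.map fun z => (inner ℝ z x, inner ℝ z y))
    (map_isometry_uniformSphere (LinearIsometryEquiv.neg ℝ (E := EuclideanSpace ℝ (Fin (q + 1)))))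
  rw [Measure.map_map (by fun_prop) (by fun_prop), Measure.map_map (by fun_prop) (by fun_prop)]
    at h
  refine Eq.trans ?_ h
  congr 1
  ext γ <;> simp

theorem map_neg_coordLaw (p : ℕ) : (coordLaw p).map (fun w => -w) = coordLaw p := by
  have h := map_isometry_uniformSphere
    (LinearIsometryEquiv.neg ℝ (E := EuclideanSpace ℝ (Fin (p + 1))))
  have h := congrArg (fun m => m.map fun z : EuclideanSpace ℝ (Fin (p + 1)) => z 0) h
  simp only at h
  rw [Measure.map_map (by fun_prop) (by fun_prop), Measure.map_map (by fun_prop) (by fun_prop)]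
    at h
  rw [coordLaw, Measure.map_map (by fun_prop) (by fun_prop)]
  exact h

theorem ae_coordLaw_mem_Icc (p : ℕ) : ∀ᵐ w ∂(coordLaw p), w ∈ Set.Icc (-1 : ℝ) 1 := by
  refine (ae_map_iff (measurable_coord p 0).aemeasurable measurableSet_Icc).2 ?_
  refine Filter.Eventually.of_forall fun γ => abs_le.1 ?_
  have := PiLp.norm_apply_le (γ : EuclideanSpace ℝ (Fin (p + 1))) 0
  rwa [norm_omega] at this

/-- Projections onto two distinct points are almost surely different. -/
theorem ae_inner_ne (hq : 1 ≤ q) {x y : Omega q} (hxy : x ≠ y) : ∀ᵐ γ : Omega q ∂(uniformSphere q),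
    inner ℝ (γ : EuclideanSpace ℝ (Fin (q + 1))) (x : EuclideanSpace ℝ (Fin (q + 1))) ≠
      inner ℝ (γ : EuclideanSpace ℝ (Fin (q + 1))) (y : EuclideanSpace ℝ (Fin (q + 1))) := by
  -- Equal projections mean that the projection onto the normalized difference is 0, a null event
  -- because that projection has no atoms.
  set d : EuclideanSpace ℝ (Fin (q + 1)) := (x : EuclideanSpace ℝ (Fin (q + 1))) - y with hd
  have hd0 : ‖d‖ ≠ 0 := norm_ne_zero_iff.2 (sub_ne_zero.2 fun h => hxy (Subtype.ext h))
  let z : Omega q := ⟨‖d‖⁻¹ • d, by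
    rw [mem_sphere_zero_iff_norm, norm_smul, norm_inv, norm_norm, inv_mul_cancel₀ hd0]⟩
  have h0 : ∀ᵐ t ∂(coordLaw q), t ≠ 0 := by
    obtain ⟨p, rfl⟩ := Nat.exists_eq_add_of_le' hq
    rw [coordLaw_succ]
    exact compl_mem_ae_iff.2 (measure_singleton (0 : ℝ))
  rw [← map_inner_uniformSphere z] at h0
  filter_upwards [ae_of_ae_map (measurable_inner_sphere _).aemeasurable h0] with γ hγ h
  refine hγ ?_
  change inner ℝ (γ : EuclideanSpace ℝ (Fin (q + 1))) (‖d‖⁻¹ • d) = (0 : ℝ)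
  rw [inner_smul_right, hd, inner_sub_right, h, sub_self, mul_zero]

theorem measurePreserving_inner (hq : 1 ≤ q) (x : Omega q) :
    MeasurePreserving (fun γ : Omega q => inner ℝ (γ : EuclideanSpace ℝ (Fin (q + 1)))
      (x : EuclideanSpace ℝ (Fin (q + 1)))) (uniformSphere q) (projLaw q) := by
  refine ⟨measurable_inner_sphere _, ?_⟩
  rw [map_inner_uniformSphere]
  obtain ⟨p, rfl⟩ := Nat.exists_eq_add_of_le' hq
  exact coordLaw_succ p

/-- Every score is uniform on (0, 1), whatever the point: its projection has distribution function
F_q. -/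
theorem measurePreserving_score (hq : 1 ≤ q) (x : Omega q) :
    MeasurePreserving (score x) (uniformSphere q) (volume.restrict (Set.Ioo 0 1)) :=
  (measurePreserving_projCDF hq).comp (measurePreserving_inner hq x)

/-! ### Averaging over directions -/

/-- The expected logit of the larger score. -/
noncomputable def meanLogitMax (x y : Omega q) : ℝ :=
  ∫ γ, logit (max (score x γ) (score y γ)) ∂(uniformSphere q)

theorem integrableOn_logit : IntegrableOn logit (Set.Ioo 0 1) :=
  integrableOn_Ioo_of_intervalIntegrable zero_le_one (intervalIntegrable_logit 0 1)

theorem integrable_logit_score (hq : 1 ≤ q) (x : Omega q) :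
    Integrable (fun γ => logit (score x γ)) (uniformSphere q) :=
  (measurePreserving_score hq x).integrable_comp_of_integrable integrableOn_logit

theorem integrable_logit_max (hq : 1 ≤ q) (x y : Omega q) :
    Integrable (fun γ => logit (max (score x γ) (score y γ))) (uniformSphere q) := by
  refine ((integrable_logit_score hq x).norm.add (integrable_logit_score hq y).norm).mono' ?_ ?_
  · exact (measurable_logit.comp ((measurePreserving_score hq x).measurable.max
      (measurePreserving_score hq y).measurable)).aestronglyMeasurable
  · refine Filter.Eventually.of_forall fun γ => ?_
    simp only [Pi.add_apply]
    rcases max_choice (score x γ) (score y γ) with h | h <;> rw [h]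
    · exact le_add_of_nonneg_right (norm_nonneg _)
    · exact le_add_of_nonneg_left (norm_nonneg _)

theorem integral_comp_score (hq : 1 ≤ q) (x : Omega q) {φ : ℝ → ℝ} (hφ : Measurable φ) :
    ∫ γ, φ (score x γ) ∂(uniformSphere q) = ∫ u in (0 : ℝ)..1, φ u := by
  have h := measurePreserving_score hq x
  rw [intervalIntegral.integral_of_le zero_le_one, integral_Ioc_eq_integral_Ioo, ← h.map_eq,
    integral_map h.measurable.aemeasurable hφ.aestronglyMeasurable]

/-- The negative entropy vanishes at both ends of [0, 1]. This is the source of the convention that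
the kernel is 0 at θ = 0. -/
theorem meanLogitMax_self (hq : 1 ≤ q) (x : Omega q) : meanLogitMax x x = 0 := by
  simp only [meanLogitMax, max_self]
  rw [integral_comp_score hq x measurable_logit, integral_logit]
  simp

theorem meanLogitMax_comm (x y : Omega q) : meanLogitMax x y = meanLogitMax y x := by
  simp only [meanLogitMax, max_comm]

theorem integral_pairEnergy (hq : 1 ≤ q) (x y : Omega q) :
    Integrable (fun γ => pairEnergy (score x γ) (score y γ)) (uniformSphere q) ∧
      ∫ γ, pairEnergy (score x γ) (score y γ) ∂(uniformSphere q) = 1 - meanLogitMax x y := by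
  have hlog : ∀ z : Omega q,
      Integrable (fun γ => Real.log (1 - score z γ)) (uniformSphere q) := fun z =>
    (measurePreserving_score hq z).integrable_comp_of_integrable (g := fun u => Real.log (1 - u))
      (integrableOn_Ioo_of_intervalIntegrable zero_le_one (intervalIntegrable_log_one_sub 0 1))
  have hval : ∀ z : Omega q, ∫ γ, Real.log (1 - score z γ) ∂(uniformSphere q) = -1 := fun z => by
    rw [integral_comp_score hq z (φ := fun u => Real.log (1 - u)) (by fun_prop),
      integral_log_one_sub]
    simp
  have h1 := (integrable_const (μ := uniformSphere q) (-1 : ℝ)).sub (integrable_logit_max hq x y)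
  have h2 := h1.sub (hlog x)
  refine ⟨h2.sub (hlog y), ?_⟩
  have e := integral_sub h2 (hlog y)
  rw [integral_sub' h1 (hlog x), integral_sub' (integrable_const _) (integrable_logit_max hq x y),
    hval, hval, integral_const, probReal_univ] at e
  refine e.trans ?_
  rw [meanLogitMax]
  simp
  ring

/-- For almost every γ all projections lie in (−1, 1), so the pairwise formula applies. The
resulting integrand is integrable and almost everywhere nonnegative, which gives finiteness and lets
the lower integral be computed term by term. -/
theorem projStat_eq (hq : 1 ≤ q) (hn : 1 ≤ n) (X : Fin n → Omega q) :
    projStat weightAD X ≠ ⊤ ∧ (projStat weightAD X).toReal =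
      (n : ℝ)⁻¹ * ∑ i, ∑ j, (1 - meanLogitMax (X i) (X j)) := by
  have hae : ∀ᵐ γ : Omega q ∂(uniformSphere q),
      ∀ i, inner ℝ (γ : EuclideanSpace ℝ (Fin (q + 1))) (X i) ∈ Set.Ioo (-1 : ℝ) 1 := by
    rw [ae_all_iff]
    intro i
    exact (measurePreserving_inner hq (X i)).quasiMeasurePreserving.ae (ae_projLaw_mem_Ioo q)
  set T : Omega q → ℝ := fun γ =>
    (n : ℝ)⁻¹ * ∑ i, ∑ j, pairEnergy (score (X i) γ) (score (X j) γ) with hT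
  have hTi : Integrable T (uniformSphere q) :=
    (integrable_finsetSum _ fun i _ => integrable_finsetSum _ fun j _ =>
      (integral_pairEnergy hq (X i) (X j)).1).const_mul _
  have hT0 : 0 ≤ᵐ[uniformSphere q] T := by
    filter_upwards [hae] with γ hγ using (quadStat_eq hq hn X γ hγ).2
  have hP : projStat weightAD X = ENNReal.ofReal (∫ γ, T γ ∂(uniformSphere q)) := by
    rw [ofReal_integral_eq_lintegral_ofReal hTi hT0, projStat]
    refine lintegral_congr_ae ?_
    filter_upwards [hae] with γ hγ using (quadStat_eq hq hn X γ hγ).1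
  refine ⟨hP ▸ ENNReal.ofReal_ne_top, ?_⟩
  rw [hP, ENNReal.toReal_ofReal (integral_nonneg_of_ae hT0), integral_const_mul,
    integral_finsetSum _ fun i _ => integrable_finsetSum _ fun j _ =>
      (integral_pairEnergy hq (X i) (X j)).1]
  congr 1
  refine Finset.sum_congr rfl fun i _ => ?_
  rw [integral_finsetSum _ fun j _ => (integral_pairEnergy hq (X i) (X j)).1]
  exact Finset.sum_congr rfl fun j _ => (integral_pairEnergy hq (X i) (X j)).2

theorem sum_sum_eq_diag_add_two_mul {f : Fin n → Fin n → ℝ} (hf : ∀ i j, f i j = f j i) :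
    ∑ i, ∑ j, f i j = ∑ i, f i i + 2 * ∑ i, ∑ j ∈ Finset.Ioi i, f i j := by
  have h1 : ∀ i, ∑ j, f i j =
      ∑ j ∈ Finset.Iio i, f i j + f i i + ∑ j ∈ Finset.Ioi i, f i j := by
    intro i
    have hu : (Finset.univ : Finset (Fin n)) = Finset.Iio i ∪ {i} ∪ Finset.Ioi i := by
      ext j
      simp only [Finset.mem_univ, Finset.mem_union, Finset.mem_Iio, Finset.mem_singleton,
        Finset.mem_Ioi, true_iff]
      rcases lt_trichotomy j i with h | h | h <;> simp [h]
    rw [hu, Finset.sum_union, Finset.sum_union, Finset.sum_singleton]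
    · simp
    · rw [Finset.disjoint_left]
      intro j hj hj'
      simp only [Finset.mem_union, Finset.mem_Iio, Finset.mem_singleton, Finset.mem_Ioi] at hj hj'
      rcases hj with hj | rfl
      · exact hj.not_gt hj'
      · exact lt_irrefl _ hj'
  have h2 : ∑ i, ∑ j ∈ Finset.Iio i, f i j = ∑ i, ∑ j ∈ Finset.Ioi i, f i j := by
    rw [Finset.sum_comm' (t' := Finset.univ) (s' := fun j => Finset.Ioi j)]
    · exact Finset.sum_congr rfl fun i _ => Finset.sum_congr rfl fun j _ => hf _ _
    · simp
  simp only [h1, Finset.sum_add_distrib, h2]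
  ring

/-- The statistic in terms of the mean logits of the larger scores. -/
theorem projStat_toReal_eq (hq : 1 ≤ q) (hn : 1 ≤ n) (X : Fin n → Omega q) :
    (projStat weightAD X).toReal =
      2 / (n : ℝ) * (∑ i, ∑ j ∈ Finset.Ioi i, -meanLogitMax (X i) (X j)) + n := by
  have hn0 : (n : ℝ) ≠ 0 := by positivity
  rw [(projStat_eq hq hn X).2]
  have h : ∑ i, ∑ j, (1 - meanLogitMax (X i) (X j)) =
      (n : ℝ) ^ 2 + ∑ i, ∑ j, -meanLogitMax (X i) (X j) := by
    simp only [sub_eq_add_neg, Finset.sum_add_distrib]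
    simp [sq]
  rw [h, sum_sum_eq_diag_add_two_mul (f := fun i j => -meanLogitMax (X i) (X j))
    fun i j => by rw [meanLogitMax_comm]]
  simp only [meanLogitMax_self hq]
  simp
  field_simp
  ring

/-! ### Reduction to one wedge -/

/-- The logit of the first coordinate where it is positive and below the second coordinate. -/
noncomputable def wedgeLogit (q : ℕ) : ℝ × ℝ → ℝ :=
  {z : ℝ × ℝ | 0 < z.1 ∧ z.1 < z.2}.indicator fun z => logitCDF q z.1

theorem measurable_wedgeLogit (hq : 1 ≤ q) : Measurable (wedgeLogit q) :=
  ((measurable_logitCDF hq).comp measurable_fst).indicator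
    ((measurableSet_lt measurable_const measurable_fst).inter
      (measurableSet_lt measurable_fst measurable_snd))

theorem norm_wedgeLogit_le (z : ℝ × ℝ) : ‖wedgeLogit q z‖ ≤ ‖logitCDF q z.1‖ :=
  norm_indicator_le_norm_self _ _

/-- The part of g(max(a,b)) carried by {b < a} is g(a)1{b < a}. For a > 0 remove from g⁺(a) the
wedge 0 < a < b; for a < 0 oddness gives −g(−a) on the wedge 0 < −a < −b. The other part exchanges a
and b. -/
theorem logitCDF_max_eq (hq : 1 ≤ q) {a b : ℝ} (ha : a ∈ Set.Ioo (-1 : ℝ) 1)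
    (hb : b ∈ Set.Ioo (-1 : ℝ) 1) (ha0 : a ≠ 0) (hb0 : b ≠ 0) (hab : a ≠ b) :
    logitCDF q (max a b) =
      ((Set.Ioi 0).indicator (logitCDF q) a - wedgeLogit q (a, b) - wedgeLogit q (-a, -b)) +
      ((Set.Ioi 0).indicator (logitCDF q) b - wedgeLogit q (b, a) - wedgeLogit q (-b, -a)) := by
  have h : ∀ a b : ℝ, a ∈ Set.Ioo (-1 : ℝ) 1 → a ≠ 0 → a ≠ b →
      (Set.Ioi 0).indicator (logitCDF q) a - wedgeLogit q (a, b) - wedgeLogit q (-a, -b) =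
        if b < a then logitCDF q a else 0 := by
    intro a b ha ha0 hab
    have hneg := logitCDF_neg hq ha
    rcases lt_or_gt_of_ne ha0 with h0 | h0 <;> rcases lt_or_gt_of_ne hab with h1 | h1 <;>
      simp [wedgeLogit, Set.indicator, h0, h1, hneg, h1.not_gt, h0.not_gt]
  rw [h a b ha ha0 hab, h b a hb hb0 hab.symm]
  rcases lt_or_gt_of_ne hab with h1 | h1 <;> simp [h1, h1.le, h1.not_gt]

/-- The mean logit of the larger score, through the law of the pair of projections. -/
theorem meanLogitMax_eq_wedge {x y : Omega (p + 1)} (hxy : x ≠ y) :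
    meanLogitMax x y = 2 * Real.log 2 -
      4 * ∫ γ : Omega (p + 1), wedgeLogit (p + 1) (inner ℝ (γ : EuclideanSpace ℝ (Fin (p + 2))) x,
        inner ℝ (γ : EuclideanSpace ℝ (Fin (p + 2))) y) ∂(uniformSphere (p + 1)) := by
  have hq : 1 ≤ p + 1 := Nat.le_add_left 1 p
  set pr : Omega (p + 1) → Omega (p + 1) → ℝ := fun z γ =>
    inner ℝ (γ : EuclideanSpace ℝ (Fin (p + 2))) (z : EuclideanSpace ℝ (Fin (p + 2))) with hpr
  have hmp : ∀ z, MeasurePreserving (pr z) (uniformSphere (p + 1)) (projLaw (p + 1)) :=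
    measurePreserving_inner hq
  have hwm := measurable_wedgeLogit hq
  have hwi : ∀ z z', Integrable (fun γ => wedgeLogit (p + 1) (pr z γ, pr z' γ))
      (uniformSphere (p + 1)) := by
    intro z z'
    refine ((hmp z).integrable_comp_of_integrable (integrable_logitCDF hq)).mono
      (hwm.comp ((hmp z).measurable.prodMk (hmp z').measurable)).aestronglyMeasurable ?_
    exact Filter.Eventually.of_forall fun γ => norm_wedgeLogit_le _
  have hlaw : ∀ z z', (uniformSphere (p + 1)).map (fun γ => (-pr z γ, -pr z' γ)) =
      (uniformSphere (p + 1)).map (fun γ => (pr z γ, pr z' γ)) := fun z z' =>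
    map_neg_pair_uniformSphere _ _
  have hpm : ∀ z z', Measurable fun γ => (pr z γ, pr z' γ) := fun z z' =>
    (hmp z).measurable.prodMk (hmp z').measurable
  have hpm' : ∀ z z', Measurable fun γ => (-pr z γ, -pr z' γ) := fun z z' =>
    (hmp z).measurable.neg.prodMk (hmp z').measurable.neg
  have hwi' : ∀ z z', Integrable (fun γ => wedgeLogit (p + 1) (-pr z γ, -pr z' γ))
      (uniformSphere (p + 1)) := by
    intro z z'
    have h1 : Integrable (wedgeLogit (p + 1))
        ((uniformSphere (p + 1)).map fun γ => (pr z γ, pr z' γ)) :=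
      (integrable_map_measure hwm.aestronglyMeasurable (hpm z z').aemeasurable).2 (hwi z z')
    rw [← hlaw] at h1
    exact h1.comp_measurable (hpm' z z')
  have hneg : ∀ z z', ∫ γ, wedgeLogit (p + 1) (-pr z γ, -pr z' γ) ∂(uniformSphere (p + 1)) =
      ∫ γ, wedgeLogit (p + 1) (pr z γ, pr z' γ) ∂(uniformSphere (p + 1)) := by
    intro z z'
    rw [← integral_map (hpm' z z').aemeasurable hwm.aestronglyMeasurable, hlaw,
      integral_map (hpm z z').aemeasurable hwm.aestronglyMeasurable]
  -- The two orders of the pair have the same angle, hence the same joint law.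
  have hswap : ∫ γ, wedgeLogit (p + 1) (pr y γ, pr x γ) ∂(uniformSphere (p + 1)) =
      ∫ γ, wedgeLogit (p + 1) (pr x γ, pr y γ) ∂(uniformSphere (p + 1)) := by
    rw [← integral_map (hpm y x).aemeasurable hwm.aestronglyMeasurable,
      ← integral_map (hpm x y).aemeasurable hwm.aestronglyMeasurable]
    simp only [hpr]
    rw [map_inner_pair_uniformSphere y x rfl,
      map_inner_pair_uniformSphere x y (congrArg Real.arccos (real_inner_comm _ _))]
  have hgi : ∀ z, Integrable (fun γ => (Set.Ioi 0).indicator (logitCDF (p + 1)) (pr z γ))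
      (uniformSphere (p + 1)) := fun z =>
    (hmp z).integrable_comp_of_integrable ((integrable_logitCDF hq).indicator measurableSet_Ioi)
  have hge : ∀ z, ∫ γ, (Set.Ioi 0).indicator (logitCDF (p + 1)) (pr z γ)
      ∂(uniformSphere (p + 1)) = Real.log 2 := by
    intro z
    rw [← integral_map (hmp z).measurable.aemeasurable
      ((measurable_logitCDF hq).indicator measurableSet_Ioi).aestronglyMeasurable,
      (hmp z).map_eq, integral_indicator measurableSet_Ioi, integral_logitCDF_Ioi hq]
  have hin : ∀ z, ∀ᵐ γ ∂(uniformSphere (p + 1)), pr z γ ∈ Set.Ioo (-1 : ℝ) 1 := fun z =>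
    (hmp z).quasiMeasurePreserving.ae (ae_projLaw_mem_Ioo _)
  have hne : ∀ z, ∀ᵐ γ ∂(uniformSphere (p + 1)), pr z γ ≠ 0 := fun z =>
    (hmp z).quasiMeasurePreserving.ae (compl_mem_ae_iff.2 (measure_singleton (0 : ℝ)))
  have hmain : meanLogitMax x y = ∫ γ,
      ((Set.Ioi 0).indicator (logitCDF (p + 1)) (pr x γ) - wedgeLogit (p + 1) (pr x γ, pr y γ)
        - wedgeLogit (p + 1) (-pr x γ, -pr y γ)) +
      ((Set.Ioi 0).indicator (logitCDF (p + 1)) (pr y γ) - wedgeLogit (p + 1) (pr y γ, pr x γ)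
        - wedgeLogit (p + 1) (-pr y γ, -pr x γ)) ∂(uniformSphere (p + 1)) := by
    refine integral_congr_ae ?_
    filter_upwards [hin x, hin y, hne x, hne y, ae_inner_ne hq hxy] with γ h1 h2 h3 h4 h5
    rw [← logitCDF_max_eq hq h1 h2 h3 h4 h5, logitCDF, (monotone_projCDF hq).map_max]
    rfl
  have i1 := fun z z' => ((hgi z).sub (hwi z z'))
  have i2 := fun z z' => (i1 z z').sub (hwi' z z')
  have e : ∀ z z', ∫ γ, ((Set.Ioi 0).indicator (logitCDF (p + 1)) (pr z γ)
      - wedgeLogit (p + 1) (pr z γ, pr z' γ) - wedgeLogit (p + 1) (-pr z γ, -pr z' γ))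
      ∂(uniformSphere (p + 1)) =
      Real.log 2 - 2 * ∫ γ, wedgeLogit (p + 1) (pr z γ, pr z' γ) ∂(uniformSphere (p + 1)) := by
    intro z z'
    refine (integral_sub (i1 z z') (hwi' z z')).trans ?_
    rw [hneg]
    have := integral_sub (hgi z) (hwi z z')
    rw [hge] at this
    refine (congrArg (· - _) this).trans ?_
    ring
  rw [hmain]
  refine (integral_add (i2 x y) (i2 y x)).trans ?_
  refine (congrArg₂ (· + ·) (e x y) (e y x)).trans ?_
  rw [hswap]
  ring

/-! ### The exceedance probability -/

/-- The conditional probability that the second projection exceeds the first one, given that the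
first one is `t` and the angle between the directions is `θ`. -/
noncomputable def exceedance (p : ℕ) (θ t : ℝ) : ℝ :=
  (coordLaw p).real {w | t * Real.sin (θ / 2) < Real.cos (θ / 2) * (√(1 - t ^ 2) * w)}

theorem half_angle_bounds {θ : ℝ} (hθ : θ ∈ Set.Ioc 0 Real.pi) :
    0 < Real.sin (θ / 2) ∧ 0 ≤ Real.cos (θ / 2) ∧ Real.cos (θ / 2) < 1 := by
  have hpi := Real.pi_pos
  have h1 : 0 < Real.sin (θ / 2) :=
    Real.sin_pos_of_pos_of_lt_pi (by linarith [hθ.1]) (by linarith [hθ.2])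
  have h2 : 0 ≤ Real.cos (θ / 2) :=
    Real.cos_nonneg_of_neg_pi_div_two_le_of_le (by linarith [hθ.1]) (by linarith [hθ.2])
  exact ⟨h1, h2, by nlinarith [Real.sin_sq_add_cos_sq (θ / 2)]⟩

/-- By the half-angle formulas the difference of the two sides has the positive factor 2 sin(θ/2).
The inequality is not divided by cos(θ/2), so θ = π is included. -/
theorem lt_second_projection_iff {θ : ℝ} (hθ : θ ∈ Set.Ioc 0 Real.pi) (t r : ℝ) :
    t < Real.cos θ * t + Real.sin θ * r ↔ t * Real.sin (θ / 2) < Real.cos (θ / 2) * r := by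
  have hs := (half_angle_bounds hθ).1
  have h1 : Real.cos θ = 1 - 2 * Real.sin (θ / 2) ^ 2 := by
    have := Real.cos_two_mul (θ / 2)
    have h2 := Real.sin_sq_add_cos_sq (θ / 2)
    rw [mul_div_cancel₀ _ (two_ne_zero' ℝ)] at this
    linarith
  have h2 : Real.sin θ = 2 * Real.sin (θ / 2) * Real.cos (θ / 2) := by
    have := Real.sin_two_mul (θ / 2)
    rwa [mul_div_cancel₀ _ (two_ne_zero' ℝ)] at this
  have h3 : Real.cos θ * t + Real.sin θ * r - t =
      2 * Real.sin (θ / 2) * (Real.cos (θ / 2) * r - t * Real.sin (θ / 2)) := by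
    rw [h1, h2]; ring
  rw [← sub_pos, h3, mul_pos_iff_of_pos_left (by positivity), sub_pos]

/-- After squaring and using sin² + cos² = 1, this is cos²(θ/2) ≤ t². It is what cuts the integral
off at cos(θ/2). -/
theorem cos_mul_sqrt_le {θ : ℝ} (hθ : θ ∈ Set.Ioc 0 Real.pi) {t : ℝ}
    (ht : Real.cos (θ / 2) ≤ t) :
    Real.cos (θ / 2) * √(1 - t ^ 2) ≤ t * Real.sin (θ / 2) := by
  obtain ⟨hs, hc, -⟩ := half_angle_bounds hθ
  have ht0 : 0 ≤ t := hc.trans ht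
  rcases le_total (1 - t ^ 2) 0 with h | h
  · rw [Real.sqrt_eq_zero_of_nonpos h]
    simp only [mul_zero]; positivity
  · refine abs_le_of_sq_le_sq' ?_ (by positivity) |>.2
    rw [mul_pow, mul_pow, Real.sq_sqrt h]
    have := Real.sin_sq_add_cos_sq (θ / 2)
    nlinarith [mul_self_le_mul_self hc ht]

theorem lt_cos_mul_sqrt {θ : ℝ} (hθ : θ ∈ Set.Ioc 0 Real.pi) {t : ℝ} (ht0 : 0 ≤ t)
    (ht : t < Real.cos (θ / 2)) :
    t * Real.sin (θ / 2) < Real.cos (θ / 2) * √(1 - t ^ 2) := by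
  obtain ⟨hs, hc, hc1⟩ := half_angle_bounds hθ
  have h : 0 ≤ 1 - t ^ 2 := by nlinarith
  refine abs_lt_of_sq_lt_sq' ?_ (by positivity) |>.2
  rw [mul_pow, mul_pow, Real.sq_sqrt h]
  have := Real.sin_sq_add_cos_sq (θ / 2)
  nlinarith [mul_self_lt_mul_self ht0 ht]

theorem exceedance_eq_zero {θ : ℝ} (hθ : θ ∈ Set.Ioc 0 Real.pi) {t : ℝ}
    (ht : Real.cos (θ / 2) ≤ t) : exceedance p θ t = 0 := by
  rw [exceedance, measureReal_def, measure_eq_zero_iff_ae_notMem.2]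
  · rfl
  filter_upwards [ae_coordLaw_mem_Icc p] with w hw h
  have h1 : Real.cos (θ / 2) * (√(1 - t ^ 2) * w) ≤ Real.cos (θ / 2) * √(1 - t ^ 2) :=
    mul_le_mul_of_nonneg_left (mul_le_of_le_one_right (Real.sqrt_nonneg _) hw.2)
      (half_angle_bounds hθ).2.1
  exact absurd (h.trans_le h1) (cos_mul_sqrt_le hθ ht).not_gt

/-- Fubini for the product law of (t, w): with t > 0 fixed, the wedge is an event in w alone and the
logit is a constant. -/
theorem integral_wedgeLogit {x y : Omega (p + 1)} {θ : ℝ}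
    (hxy : Real.arccos (inner ℝ (x : EuclideanSpace ℝ (Fin (p + 2))) y) = θ)
    (hθ : θ ∈ Set.Ioc 0 Real.pi) :
    ∫ γ : Omega (p + 1), wedgeLogit (p + 1) (inner ℝ (γ : EuclideanSpace ℝ (Fin (p + 2))) x,
        inner ℝ (γ : EuclideanSpace ℝ (Fin (p + 2))) y) ∂(uniformSphere (p + 1)) =
      ∫ t in Set.Icc 0 (Real.cos (θ / 2)), logitCDF (p + 1) t * exceedance p θ t
        ∂(projLaw (p + 1)) := by
  have hq : 1 ≤ p + 1 := Nat.le_add_left 1 p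
  have hwm := measurable_wedgeLogit hq
  set m : ℝ × ℝ → ℝ × ℝ := fun t =>
    (t.1, Real.cos θ * t.1 + Real.sin θ * (√(1 - t.1 ^ 2) * t.2)) with hm
  have hmm : Measurable m := by fun_prop
  have hpm : Measurable fun γ : Omega (p + 1) =>
      (inner ℝ (γ : EuclideanSpace ℝ (Fin (p + 2))) (x : EuclideanSpace ℝ (Fin (p + 2))),
        inner ℝ (γ : EuclideanSpace ℝ (Fin (p + 2))) (y : EuclideanSpace ℝ (Fin (p + 2)))) := by
    fun_prop
  have hint : Integrable (fun z => wedgeLogit (p + 1) (m z))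
      ((projLaw (p + 1)).prod (coordLaw p)) := by
    refine ((integrable_logitCDF hq).comp_fst (coordLaw p)).mono
      (hwm.comp hmm).aestronglyMeasurable ?_
    exact Filter.Eventually.of_forall fun z => norm_wedgeLogit_le _
  rw [← integral_map hpm.aemeasurable hwm.aestronglyMeasurable,
    map_inner_pair_uniformSphere x y hxy, integral_map hmm.aemeasurable hwm.aestronglyMeasurable,
    integral_prod _ hint, ← integral_indicator measurableSet_Icc]
  refine integral_congr_ae ?_
  have h0 : ∀ᵐ t ∂(projLaw (p + 1)), t ≠ 0 := compl_mem_ae_iff.2 (measure_singleton (0 : ℝ))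
  filter_upwards [h0] with t ht0
  have hS : MeasurableSet {w | t * Real.sin (θ / 2) < Real.cos (θ / 2) * (√(1 - t ^ 2) * w)} :=
    measurableSet_lt (by fun_prop) (by fun_prop)
  rcases lt_or_ge 0 t with ht | ht
  · have h1 : (fun w => wedgeLogit (p + 1) (m (t, w))) =
        {w | t * Real.sin (θ / 2) < Real.cos (θ / 2) * (√(1 - t ^ 2) * w)}.indicator
          fun _ => logitCDF (p + 1) t := by
      ext w
      simp only [wedgeLogit, hm, Set.indicator, Set.mem_ofPred_eq, ht, true_and,
        lt_second_projection_iff hθ]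
    rw [h1, integral_indicator hS, setIntegral_const, smul_eq_mul, mul_comm]
    change logitCDF (p + 1) t * exceedance p θ t = _
    by_cases htc : t ≤ Real.cos (θ / 2)
    · rw [Set.indicator_of_mem (show t ∈ Set.Icc 0 (Real.cos (θ / 2)) from ⟨ht.le, htc⟩)]
    · rw [Set.indicator_of_notMem (fun h => htc h.2), exceedance_eq_zero hθ (not_le.1 htc).le,
        mul_zero]
  · have h1 : (fun w => wedgeLogit (p + 1) (m (t, w))) = fun _ => 0 := by
      ext w
      simp [wedgeLogit, hm, ht.not_gt]
    rw [h1, integral_zero, Set.indicator_of_notMem]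
    exact fun h => ht0 (le_antisymm ht h.1)

/-- The Anderson–Darling kernel through the exceedance probability. -/
noncomputable def exceedanceKernel (p : ℕ) (θ : ℝ) : ℝ :=
  -Real.log 4 + 4 * ∫ t in Set.Icc 0 (Real.cos (θ / 2)), logitCDF (p + 1) t * exceedance p θ t
    ∂(projLaw (p + 1))

theorem log_four : Real.log 4 = 2 * Real.log 2 := by
  rw [show (4 : ℝ) = 2 ^ 2 by norm_num, Real.log_pow]; norm_num

theorem neg_meanLogitMax_eq {x y : Omega (p + 1)} {θ : ℝ}
    (hxy : Real.arccos (inner ℝ (x : EuclideanSpace ℝ (Fin (p + 2))) y) = θ)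
    (hθ : θ ∈ Set.Ioc 0 Real.pi) : -meanLogitMax x y = exceedanceKernel p θ := by
  have hne : x ≠ y := by
    rintro rfl
    rw [real_inner_self_eq_norm_sq, norm_omega] at hxy
    norm_num at hxy
    exact hθ.1.ne hxy
  rw [meanLogitMax_eq_wedge hne, integral_wedgeLogit hxy hθ, exceedanceKernel, log_four]
  ring

/-- Dividing by cos(θ/2)√(1 − t²) > 0 isolates w, whose law is that of a projection one dimension
lower. -/
theorem exceedance_eq_projCDF {θ t : ℝ} (ht : t ∈ Set.Ioo (-1 : ℝ) 1)
    (hc : 0 < Real.cos (θ / 2)) :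
    exceedance (p + 1) θ t =
      1 - projCDF (p + 1) (t * Real.tan (θ / 2) / Real.sqrt (1 - t ^ 2)) := by
  have hr : 0 < √(1 - t ^ 2) := Real.sqrt_pos.2 (by nlinarith [ht.1, ht.2])
  have h1 : {w | t * Real.sin (θ / 2) < Real.cos (θ / 2) * (√(1 - t ^ 2) * w)} =
      (Set.Iic (t * Real.tan (θ / 2) / Real.sqrt (1 - t ^ 2)))ᶜ := by
    ext w
    simp only [Set.mem_ofPred_eq, Set.compl_Iic, Set.mem_Ioi]
    rw [div_lt_iff₀ hr, Real.tan_eq_sin_div_cos, mul_div_assoc', div_lt_iff₀ hc]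
    ring_nf
  rw [exceedance, h1, coordLaw_succ, probReal_compl_eq_one_sub measurableSet_Iic, projCDF]

theorem setIntegral_Icc_zero_zero (q : ℕ) (f : ℝ → ℝ) :
    ∫ t in Set.Icc 0 0, f t ∂(projLaw q) = 0 := by
  rw [Set.Icc_self, Measure.restrict_singleton, measure_singleton]
  simp

theorem exceedanceKernel_succ {θ : ℝ} (hθ : θ ∈ Set.Ioc 0 Real.pi) :
    exceedanceKernel (p + 1) θ = kernelADIntegral (p + 2) θ := by
  obtain ⟨-, hc, hc1⟩ := half_angle_bounds hθ
  rw [exceedanceKernel, kernelADIntegral]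
  congr 2
  rcases hc.eq_or_lt with hc0 | hc0
  -- At θ = π the tangent formula is unavailable, but both integrals are over the null set {0}.
  · rw [← hc0, setIntegral_Icc_zero_zero, setIntegral_Icc_zero_zero]
  · refine setIntegral_congr_fun measurableSet_Icc fun t ht => ?_
    change _ = logitCDF (p + 2) t * _
    rw [exceedance_eq_projCDF ⟨by linarith [ht.1], ht.2.trans_lt hc1⟩ hc0]
    rfl

/-! ### The zero-dimensional sphere, for q = 1 -/

theorem ae_abs_coordLaw_zero : ∀ᵐ w ∂(coordLaw 0), |w| = 1 := by
  refine (ae_map_iff (measurable_coord 0 0).aemeasurable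
    (measurableSet_eq_fun measurable_norm measurable_const)).2 ?_
  refine Filter.Eventually.of_forall fun γ => ?_
  have h := norm_omega γ
  rw [EuclideanSpace.norm_eq, Fin.sum_univ_one, Real.sqrt_sq (norm_nonneg _)] at h
  exact h

theorem coordLaw_zero_Ioi : (coordLaw 0).real (Set.Ioi 0) = 1 / 2 := by
  have h1 : (coordLaw 0).real (Set.Iio 0) = (coordLaw 0).real (Set.Ioi 0) := by
    conv_rhs => rw [← map_neg_coordLaw 0]
    rw [map_measureReal_apply measurable_neg measurableSet_Ioi]
    simp
  have h2 : (coordLaw 0).real (Set.Ioi 0)ᶜ = (coordLaw 0).real (Set.Iio 0) := by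
    refine measureReal_congr ?_
    filter_upwards [ae_abs_coordLaw_zero] with w hw
    refine propext ?_
    change ¬ (0 < w) ↔ w < 0
    have : w ≠ 0 := by rintro rfl; simp at hw
    rw [not_lt]
    exact ⟨fun h => lt_of_le_of_ne h this, le_of_lt⟩
  rw [probReal_compl_eq_one_sub measurableSet_Ioi] at h2
  linarith

/-- Here w is almost surely ±1, and below the cutoff the threshold is nonnegative and beaten by w =
1, so only the sign of w decides. Symmetry gives one half. -/
theorem exceedance_zero {θ t : ℝ} (hθ : θ ∈ Set.Ioc 0 Real.pi) (ht0 : 0 ≤ t)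
    (ht : t < Real.cos (θ / 2)) : exceedance 0 θ t = 1 / 2 := by
  obtain ⟨hs, hc, -⟩ := half_angle_bounds hθ
  rw [exceedance, ← coordLaw_zero_Ioi]
  refine measureReal_congr ?_
  filter_upwards [ae_abs_coordLaw_zero] with w hw
  refine propext ?_
  change t * Real.sin (θ / 2) < Real.cos (θ / 2) * (√(1 - t ^ 2) * w) ↔ 0 < w
  have h := lt_cos_mul_sqrt hθ ht0 ht
  rw [← mul_assoc]
  constructor
  · intro h2
    refine pos_of_mul_pos_right (lt_of_le_of_lt (by positivity) h2) (by positivity)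
  · intro h2
    rw [abs_of_pos h2] at hw
    rwa [hw, mul_one]

/-! ### Explicit densities, distribution functions and kernels for q = 1, 2, 3 -/

theorem setIntegral_projLaw (hq : 1 ≤ q) {c : ℝ} (hc0 : 0 ≤ c) (hc : c ≤ 1) (f : ℝ → ℝ) :
    ∫ t in Set.Icc 0 c, f t ∂(projLaw q) = ∫ t in (0 : ℝ)..c, projDensity q t * f t := by
  have hsub : Set.Icc 0 c ⊆ Set.Icc (-1) 1 := Set.Icc_subset_Icc (by norm_num) hc
  rw [projLaw, restrict_withDensity measurableSet_Icc, Measure.restrict_restrict measurableSet_Icc,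
    Set.inter_eq_left.2 hsub, integral_withDensity_eq_integral_toReal_smul
      (measurable_projDensity q).ennreal_ofReal (by simp),
    intervalIntegral.integral_of_le hc0, ← integral_Icc_eq_integral_Ioc]
  refine setIntegral_congr_fun measurableSet_Icc fun t ht => ?_
  simp only [smul_eq_mul]
  rw [ENNReal.toReal_ofReal (projDensity_nonneg hq (hsub ht))]

theorem gamma_three_halves : Real.Gamma (3 / 2) = √Real.pi / 2 := by
  rw [show (3 : ℝ) / 2 = 1 / 2 + 1 by norm_num, Real.Gamma_add_one (by norm_num),
    Real.Gamma_one_half_eq]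
  ring

theorem projDensity_one {t : ℝ} (ht : 0 ≤ 1 - t ^ 2) :
    projDensity 1 t = 1 / Real.pi * (1 / √(1 - t ^ 2)) := by
  have hB : ProbabilityTheory.beta (1 / 2) (((1 : ℕ) : ℝ) / 2) = Real.pi := by
    rw [ProbabilityTheory.beta, Nat.cast_one, Real.Gamma_one_half_eq, add_halves, Real.Gamma_one,
      div_one, Real.mul_self_sqrt Real.pi_pos.le]
  have he : ((1 : ℕ) : ℝ) / 2 - 1 = -(1 / 2) := by norm_num
  rw [projDensity, hB, he, Real.rpow_neg ht, ← Real.sqrt_eq_rpow]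
  simp

theorem projDensity_two (t : ℝ) : projDensity 2 t = 1 / 2 := by
  have hB : ProbabilityTheory.beta (1 / 2) (((2 : ℕ) : ℝ) / 2) = 2 := by
    have h : (0 : ℝ) < √Real.pi := Real.sqrt_pos.2 Real.pi_pos
    rw [ProbabilityTheory.beta, Nat.cast_ofNat, div_self two_ne_zero, Real.Gamma_one,
      show (1 : ℝ) / 2 + 1 = 3 / 2 by norm_num, gamma_three_halves, Real.Gamma_one_half_eq]
    field_simp
  rw [projDensity, hB]
  simp

theorem projDensity_three (t : ℝ) : projDensity 3 t = 2 / Real.pi * √(1 - t ^ 2) := by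
  have hB : ProbabilityTheory.beta (1 / 2) (((3 : ℕ) : ℝ) / 2) = Real.pi / 2 := by
    rw [ProbabilityTheory.beta, Nat.cast_ofNat, gamma_three_halves, Real.Gamma_one_half_eq,
      show (1 : ℝ) / 2 + 3 / 2 = 2 by norm_num, Real.Gamma_two, div_one, ← mul_div_assoc,
      Real.mul_self_sqrt Real.pi_pos.le]
  have he : ((3 : ℕ) : ℝ) / 2 - 1 = 1 / 2 := by norm_num
  rw [projDensity, hB, he, ← Real.sqrt_eq_rpow, inv_div]

/-- No upper bound on x is needed, since both sides equal 1 beyond 1. The q = 2 kernel can thus be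
evaluated without bounding its argument above. -/
theorem projCDF_one {x : ℝ} (hx : -1 ≤ x) : projCDF 1 x = 1 - Real.arccos x / Real.pi := by
  have hpi := Real.pi_ne_zero
  rcases le_total 1 x with h1 | h1
  · rw [projCDF_of_one_le le_rfl h1, Real.arccos_of_one_le h1]; simp
  refine projCDF_eq_of_hasDerivAt (G := fun x => 1 - Real.arccos x / Real.pi) le_rfl ?_ ?_ ?_
    ⟨hx, h1⟩
  · exact (continuous_const.sub (Real.continuous_arccos.div_const _)).continuousOn
  · simp [hpi]
  · intro t ht
    have h := ((Real.hasDerivAt_arccos ht.1.ne' ht.2.ne).div_const Real.pi).const_sub 1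
    refine h.congr_deriv ?_
    rw [projDensity_one (by nlinarith [ht.1, ht.2])]
    ring

theorem projCDF_two {x : ℝ} (hx : x ∈ Set.Icc (-1 : ℝ) 1) : projCDF 2 x = (1 + x) / 2 := by
  refine projCDF_eq_of_hasDerivAt (G := fun x => (1 + x) / 2) one_le_two ?_ (by norm_num) ?_ hx
  · fun_prop
  · intro t _
    rw [projDensity_two]
    exact ((hasDerivAt_id t).const_add 1).div_const 2

theorem projCDF_three {x : ℝ} (hx : x ∈ Set.Icc (-1 : ℝ) 1) :
    projCDF 3 x = 1 - (Real.arccos x - x * √(1 - x ^ 2)) / Real.pi := by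
  have hpi := Real.pi_ne_zero
  refine projCDF_eq_of_hasDerivAt
    (G := fun x => 1 - (Real.arccos x - x * √(1 - x ^ 2)) / Real.pi) (by norm_num) ?_ ?_ ?_ hx
  · have := Real.continuous_arccos
    exact Continuous.continuousOn (by fun_prop)
  · simp [hpi]
  · intro t ht
    have hp : 0 < 1 - t ^ 2 := by nlinarith [ht.1, ht.2]
    have hr : 0 < √(1 - t ^ 2) := Real.sqrt_pos.2 hp
    have h1 : HasDerivAt (fun x : ℝ => 1 - x ^ 2) (-(2 * t)) t := by
      simpa using (hasDerivAt_pow 2 t).const_sub 1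
    have h := (((Real.hasDerivAt_arccos ht.1.ne' ht.2.ne).sub
      ((hasDerivAt_id t).mul (h1.sqrt hp.ne'))).div_const Real.pi).const_sub 1
    refine h.congr_deriv ?_
    rw [projDensity_three]
    have hsq := Real.sq_sqrt hp.le
    simp only [id]
    field_simp
    rw [hsq]
    ring

/-- The closed form of an integrated logit in terms of `s = 2π (1 - u)`. -/
theorem entropy_eq {s : ℝ} (h0 : 0 < s) (h1 : s < 2 * Real.pi) :
    -Real.log 4 + 2 * ((1 - s / (2 * Real.pi)) * Real.log (1 - s / (2 * Real.pi)) +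
      (1 - (1 - s / (2 * Real.pi))) * Real.log (1 - (1 - s / (2 * Real.pi))) + Real.log 2) =
    -2 * Real.log (2 * Real.pi) + 1 / Real.pi *
      (s * Real.log s + (2 * Real.pi - s) * Real.log (2 * Real.pi - s)) := by
  have hpi := Real.pi_pos
  have h2 : 1 - s / (2 * Real.pi) = (2 * Real.pi - s) / (2 * Real.pi) := by field_simp
  rw [sub_sub_cancel, h2, Real.log_div (by linarith) (by positivity),
    Real.log_div h0.ne' (by positivity), log_four]
  field_simp
  ring

theorem arccos_cos_half {θ : ℝ} (hθ : θ ∈ Set.Ioc 0 Real.pi) :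
    Real.arccos (Real.cos (θ / 2)) = θ / 2 :=
  Real.arccos_cos (by linarith [hθ.1]) (by linarith [hθ.2, Real.pi_pos])

theorem exceedanceKernel_zero {θ : ℝ} (hθ : θ ∈ Set.Ioc 0 Real.pi) :
    exceedanceKernel 0 θ = kernelADOne θ := by
  obtain ⟨-, hc, hc1⟩ := half_angle_bounds hθ
  have h1 : ∫ t in Set.Icc 0 (Real.cos (θ / 2)), logitCDF 1 t * exceedance 0 θ t ∂(projLaw 1) =
      ∫ t in Set.Icc 0 (Real.cos (θ / 2)), logitCDF 1 t * (1 / 2) ∂(projLaw 1) := by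
    -- The endpoint t = cos(θ/2) is dropped as a null set: the value one half is only available
    -- strictly below it.
    rw [setIntegral_congr_set Ico_ae_eq_Icc.symm, setIntegral_congr_set Ico_ae_eq_Icc.symm]
    exact setIntegral_congr_fun measurableSet_Ico fun t ht => by
      simp only [exceedance_zero hθ ht.1 ht.2]
  have h2 : projCDF 1 (Real.cos (θ / 2)) = 1 - θ / (2 * Real.pi) := by
    rw [projCDF_one (by linarith), arccos_cos_half hθ, div_div]
  have h3 := entropy_eq hθ.1 (by linarith [hθ.2, Real.pi_pos])
  rw [exceedanceKernel, kernelADOne, ← h3, h1, integral_mul_const,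
    integral_logitCDF_zero le_rfl hc hc1.le, h2]
  ring

theorem kernelADIntegral_two {θ : ℝ} (hθ : θ ∈ Set.Ioc 0 Real.pi) :
    kernelADIntegral 2 θ = kernelADTwo θ := by
  obtain ⟨hs, hc, hc1⟩ := half_angle_bounds hθ
  have hpi := Real.pi_ne_zero
  rw [kernelADIntegral, kernelADTwo, setIntegral_projLaw one_le_two hc hc1.le]
  have h : ∫ t in (0 : ℝ)..Real.cos (θ / 2), projDensity 2 t *
      (Real.log (projCDF 2 t / (1 - projCDF 2 t)) *
        (1 - projCDF (2 - 1) (t * Real.tan (θ / 2) / √(1 - t ^ 2)))) =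
      ∫ t in (0 : ℝ)..Real.cos (θ / 2), 1 / (2 * Real.pi) * (Real.log ((1 + t) / (1 - t)) *
        Real.arccos (t * Real.tan (θ / 2) / √(1 - t ^ 2))) := by
    refine intervalIntegral.integral_congr fun t ht => ?_
    rw [Set.uIcc_of_le hc] at ht
    have htan : 0 ≤ Real.tan (θ / 2) := by
      rw [Real.tan_eq_sin_div_cos]; positivity
    have h0 : 0 ≤ t * Real.tan (θ / 2) / √(1 - t ^ 2) :=
      div_nonneg (mul_nonneg ht.1 htan) (Real.sqrt_nonneg _)
    have ht1 : t < 1 := ht.2.trans_lt hc1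
    have h1 : (1 + t) / 2 / (1 - (1 + t) / 2) = (1 + t) / (1 - t) := by
      rw [show 1 - (1 + t) / 2 = (1 - t) / 2 by ring, div_div_div_cancel_right₀ two_ne_zero]
    rw [projDensity_two, projCDF_two ⟨by linarith [ht.1], ht1.le⟩, h1, projCDF_one (by linarith),
      sub_sub_cancel]
    field_simp
  rw [h, intervalIntegral.integral_const_mul, ← mul_assoc]
  congr 2
  field_simp
  norm_num

theorem continuousOn_logitCDF (hq : 1 ≤ q) : ContinuousOn (logitCDF q) (Set.Ioo (-1) 1) := by
  have hc := (continuous_projCDF hq).continuousOn (s := Set.Ioo (-1) 1)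
  have h := fun t ht => projCDF_mem_Ioo hq (x := t) ht
  refine ContinuousOn.log (hc.div (continuousOn_const.sub hc) fun t ht => ?_) fun t ht => ?_
  · exact (sub_pos.2 (h t ht).2).ne'
  · exact (div_pos (h t ht).1 (sub_pos.2 (h t ht).2)).ne'

theorem logitCDF_three {t : ℝ} (ht : t ∈ Set.Ioo (-1 : ℝ) 1) :
    logitCDF 3 t = Real.log (Real.pi / (Real.arccos t - t * √(1 - t ^ 2)) - 1) := by
  have h := projCDF_mem_Ioo (q := 3) (by norm_num) ht
  have hpi := Real.pi_pos
  rw [projCDF_three (Set.Ioo_subset_Icc_self ht)] at h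
  rw [logitCDF, logit, projCDF_three (Set.Ioo_subset_Icc_self ht), sub_sub_cancel]
  have h1 : 0 < (Real.arccos t - t * √(1 - t ^ 2)) / Real.pi := by linarith [h.2]
  have h2 : Real.arccos t - t * √(1 - t ^ 2) ≠ 0 := by
    intro h0; rw [h0, zero_div] at h1; exact lt_irrefl _ h1
  congr 1
  field_simp

/-- Since F_2 is affine on [−1, 1], the exceedance is 1/2 − t tan(θ/2)/(2√(1 − t²)), and the density
(2/π)√(1 − t²) cancels the root. The first term integrates to a negative entropy at F_3(cos(θ/2)) =
1 − (θ − sin θ)/(2π); the second is the remaining integral. -/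
theorem kernelADIntegral_three {θ : ℝ} (hθ : θ ∈ Set.Ioc 0 Real.pi) :
    kernelADIntegral 3 θ = kernelADThree θ := by
  obtain ⟨hs, hc, hc1⟩ := half_angle_bounds hθ
  have hq : 1 ≤ 3 := by norm_num
  have hpi := Real.pi_pos
  set c := Real.cos (θ / 2) with hcdef
  have hsub : Set.Icc 0 c ⊆ Set.Ioo (-1) 1 := fun t ht =>
    ⟨by linarith [ht.1], ht.2.trans_lt hc1⟩
  have hcont : ContinuousOn (logitCDF 3) (Set.Icc 0 c) := (continuousOn_logitCDF hq).mono hsub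
  have hi1 : IntervalIntegrable (fun t => projDensity 3 t * logitCDF 3 t) volume 0 c := by
    refine ContinuousOn.intervalIntegrable_of_Icc hc (ContinuousOn.mul ?_ hcont)
    rw [show projDensity 3 = _ from funext projDensity_three]
    fun_prop
  have hi2 : IntervalIntegrable (fun t => t * logitCDF 3 t) volume 0 c :=
    ContinuousOn.intervalIntegrable_of_Icc hc (continuousOn_id.mul hcont)
  -- An inequality rather than an equality, so as to cover θ = π, where the left side is 0.
  have htanc : Real.tan (θ / 2) * c ≤ Real.sin (θ / 2) := by
    rw [Real.tan_eq_sin_div_cos, ← hcdef]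
    rcases hc.eq_or_lt with h0 | h0
    · rw [← h0, mul_zero]; exact hs.le
    · rw [div_mul_cancel₀ _ h0.ne']
  have h : ∫ t in (0 : ℝ)..c, projDensity 3 t *
      (Real.log (projCDF 3 t / (1 - projCDF 3 t)) *
        (1 - projCDF (3 - 1) (t * Real.tan (θ / 2) / √(1 - t ^ 2)))) =
      ∫ t in (0 : ℝ)..c, (1 / 2 * (projDensity 3 t * logitCDF 3 t) -
        Real.tan (θ / 2) / Real.pi * (t * logitCDF 3 t)) := by
    refine intervalIntegral.integral_congr fun t ht => ?_
    rw [Set.uIcc_of_le hc] at ht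
    have ht' := hsub ht
    have hr : 0 < √(1 - t ^ 2) := Real.sqrt_pos.2 (by nlinarith [ht'.1, ht'.2])
    have htan : 0 ≤ Real.tan (θ / 2) := by
      rw [Real.tan_eq_sin_div_cos]; positivity
    have h0 : 0 ≤ t * Real.tan (θ / 2) / √(1 - t ^ 2) :=
      div_nonneg (mul_nonneg ht.1 htan) (Real.sqrt_nonneg _)
    have hsr : Real.sin (θ / 2) ≤ √(1 - t ^ 2) := by
      refine Real.le_sqrt_of_sq_le ?_
      have := Real.sin_sq_add_cos_sq (θ / 2)
      nlinarith [mul_self_le_mul_self ht.1 ht.2]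
    -- The argument of F_2 must stay in [−1, 1] for the affine formula; the cutoff t ≤ cos(θ/2)
    -- ensures it.
    have h1 : t * Real.tan (θ / 2) / √(1 - t ^ 2) ≤ 1 := by
      rw [div_le_one hr]
      calc t * Real.tan (θ / 2) ≤ c * Real.tan (θ / 2) :=
            mul_le_mul_of_nonneg_right ht.2 htan
        _ = Real.tan (θ / 2) * c := mul_comm _ _
        _ ≤ √(1 - t ^ 2) := htanc.trans hsr
    change projDensity 3 t * (logitCDF 3 t * (1 - projCDF 2 _)) = _
    rw [projCDF_two ⟨by linarith, h1⟩, projDensity_three]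
    field_simp
    ring
  have hv : ∫ t in (0 : ℝ)..c, projDensity 3 t * logitCDF 3 t =
      projCDF 3 c * Real.log (projCDF 3 c) +
        (1 - projCDF 3 c) * Real.log (1 - projCDF 3 c) + Real.log 2 := by
    rw [← setIntegral_projLaw hq hc hc1.le, integral_logitCDF_zero hq hc hc1.le]
  have hF : projCDF 3 c = 1 - (θ - Real.sin θ) / (2 * Real.pi) := by
    have h1 : √(1 - c ^ 2) = Real.sin (θ / 2) := by
      rw [hcdef, ← Real.sin_sq, Real.sqrt_sq hs.le]
    have h2 : Real.sin θ = 2 * Real.sin (θ / 2) * c := by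
      have := Real.sin_two_mul (θ / 2)
      rwa [mul_div_cancel₀ _ (two_ne_zero' ℝ)] at this
    rw [projCDF_three ⟨by linarith, hc1.le⟩, h1, hcdef, arccos_cos_half hθ, h2, hcdef]
    field_simp
  have hl : ∫ t in (0 : ℝ)..c, t * logitCDF 3 t = ∫ t in (0 : ℝ)..c,
      t * Real.log (Real.pi / (Real.arccos t - t * √(1 - t ^ 2)) - 1) := by
    refine intervalIntegral.integral_congr fun t ht => ?_
    rw [Set.uIcc_of_le hc] at ht
    rw [logitCDF_three (hsub ht)]
  have h0 : 0 < θ - Real.sin θ := sub_pos.2 (Real.sin_lt hθ.1)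
  have h2 : θ - Real.sin θ < 2 * Real.pi := by
    linarith [hθ.2, Real.sin_nonneg_of_nonneg_of_le_pi hθ.1.le hθ.2]
  rw [kernelADIntegral, kernelADThree, ← entropy_eq h0 h2, setIntegral_projLaw hq hc hc1.le, h,
    intervalIntegral.integral_sub (hi1.const_mul _) (hi2.const_mul _),
    intervalIntegral.integral_const_mul, intervalIntegral.integral_const_mul, hv, hF, hl]
  ring

/-! ### Identification of the kernel -/

theorem kernelAD_eq_kernelADIntegral (hq : 2 ≤ q) {θ : ℝ} (hθ : θ ∈ Set.Ioc 0 Real.pi) :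
    kernelAD q θ = kernelADIntegral q θ := by
  rw [kernelAD, if_neg hθ.1.ne', if_neg (by omega)]
  split_ifs with h2 h3
  · rw [h2, kernelADIntegral_two hθ]
  · rw [h3, kernelADIntegral_three hθ]
  · rfl

theorem neg_meanLogitMax_eq_kernelAD (hq : 1 ≤ q) (x y : Omega q) :
    -meanLogitMax x y =
      kernelAD q (Real.arccos (inner ℝ (x : EuclideanSpace ℝ (Fin (q + 1))) y)) := by
  obtain ⟨p, rfl⟩ := Nat.exists_eq_add_of_le' hq
  set θ := Real.arccos (inner ℝ (x : EuclideanSpace ℝ (Fin (p + 2))) y) with hθ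
  rcases (Real.arccos_nonneg (inner ℝ (x : EuclideanSpace ℝ (Fin (p + 2))) y)).eq_or_lt
    with h0 | h0
  -- Angle 0 forces the unit vectors to coincide, by the equality case of Cauchy–Schwarz, and then
  -- the mean logit is 0.
  · have h1 : (1 : ℝ) ≤ inner ℝ (x : EuclideanSpace ℝ (Fin (p + 2))) y :=
      Real.arccos_eq_zero.1 h0.symm
    have h2 : (x : EuclideanSpace ℝ (Fin (p + 2))) = y := by
      refine (inner_eq_one_iff_of_norm_eq_one (𝕜 := ℝ) (norm_omega x) (norm_omega y)).1 ?_
      refine le_antisymm ?_ h1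
      simpa using real_inner_le_norm (x : EuclideanSpace ℝ (Fin (p + 2))) y
    rw [hθ, ← h0, Subtype.ext h2, meanLogitMax_self hq, kernelAD, if_pos rfl, neg_zero]
  · have hI : θ ∈ Set.Ioc 0 Real.pi := ⟨h0, Real.arccos_le_pi _⟩
    rw [neg_meanLogitMax_eq hθ.symm hI]
    rcases p with _ | p
    · rw [exceedanceKernel_zero hI, kernelAD, if_neg h0.ne', if_pos rfl]
    · rw [exceedanceKernel_succ hI, kernelAD_eq_kernelADIntegral (by omega) hI]

end ProjectedECDF

/-- The first conjunct is the U-statistic form of the Anderson–Darling statistic with the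
kernel given case by case; the second says that for every `q ≥ 2`, so also for `q = 2, 3`, the kernel
equals the general integral expression on `(0, π]`. -/
theorem mainTheorem7 :
    (∀ q n : ℕ, 1 ≤ q → 1 ≤ n → ∀ X : Fin n → ProjectedECDF.Omega q,
      ProjectedECDF.projStat ProjectedECDF.weightAD X ≠ ⊤ ∧
      (ProjectedECDF.projStat ProjectedECDF.weightAD X).toReal =
        2 / (n : ℝ) * (∑ i : Fin n, ∑ j ∈ Finset.Ioi i,
          ProjectedECDF.kernelAD q (ProjectedECDF.pairAngle X i j)) + n) ∧
    (∀ q : ℕ, 2 ≤ q → ∀ θ ∈ Set.Ioc (0 : ℝ) Real.pi,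
      ProjectedECDF.kernelAD q θ = ProjectedECDF.kernelADIntegral q θ) := by
  refine ⟨fun q n hq hn X => ⟨(ProjectedECDF.projStat_eq hq hn X).1, ?_⟩,
    fun q hq θ hθ => ProjectedECDF.kernelAD_eq_kernelADIntegral hq hθ⟩
  rw [ProjectedECDF.projStat_toReal_eq hq hn X]
  simp only [ProjectedECDF.neg_meanLogitMax_eq_kernelAD hq, ProjectedECDF.pairAngle]
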